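/- Let $\Omega\subset\mathbb R^3$ be open and bounded, let $Y=[-\tfrac12,\tfrac12)^3$, let $\chi_f$ be the $Y$-periodic extension to $\mathbb R^3$ of the indicator function of a measurable set of points of $Y$ (the inclusion phase), and let $\chi_m=1-\chi_f$. Let $\lambda,\gamma,\delta,C_f,C_m,C_i,\rho_f,\rho_m$ be positive constants and put $$\rho=\rho_f\chi_f+\rho_m\chi_m,\qquad \alpha(y,\hat y)=C_f\chi_f(y)\chi_f(\hat y)+C_m\chi_m(y)\chi_m(\hat y)+C_i\big(\chi_f(y)\chi_m(\hat y)+\chi_m(y)\chi_f(\hat y)\big).$$ Write $H_r(x)$ for the ball of radius $r$ about $x$. Let $T>0$, $\tfrac32<p<\infty$, let $u_0,v_0\in L^p_{\mathrm{per}}(Y;C(\overline\Omega)^3)$ and $b\in C([0,T];L^p_{\mathrm{per}}(Y;C(\overline\Omega)^3))$; elements of $L^p_{\mathrm{per}}(Y;C(\overline\Omega)^3)$ are extended $Y$-periodically in $y$. For every $\varepsilon>0$ let $u^\varepsilon\in C^2([0,T];L^p(\Omega)^3)$ be the solution of the peridynamic equation $$\rho\big(\tfrac x\varepsilon\big)\partial_t^2u^\varepsilon(x,t)=\int_{H_\gamma(x)\cap\Omega}\lambda\frac{(\hat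 x-x)\otimes(\hat x-x)}{|\hat x-x|^3}\big(u^\varepsilon(\hat x,t)-u^\varepsilon(x,t)\big)d\hat x+\int_{H_{\varepsilon\delta}(x)\cap\Omega}\frac1{\varepsilon^2}\alpha\big(\tfrac x\varepsilon,\tfrac{\hat x}\varepsilon\big)\frac{(\hat x-x)\otimes(\hat x-x)}{|\hat x-x|^3}\big(u^\varepsilon(\hat x,t)-u^\varepsilon(x,t)\big)d\hat x+b\big(x,\tfrac x\varepsilon,t\big)$$ in $\Omega\times[0,T]$ with $u^\varepsilon(x,0)=u_0(x,\tfrac x\varepsilon)$ and $\partial_tu^\varepsilon(x,0)=v_0(x,\tfrac x\varepsilon)$. Let $u\in C^2([0,T];L^p_{\mathrm{per}}(Y;C(\overline\Omega)^3))$ be the solution of the two-scale equation $$\rho(y)\partial_t^2u(x,y,t)=\int_{H_\gamma(x)\cap\Omega}\lambda\frac{(\hat x-x)\otimes(\hat x-x)}{|\hat x-x|^3}\Big(\int_Yu(\hat x,y',t)\,dy'-u(x,y,t)\Big)d\hat x+\int_{H_\delta(y)}\alpha(y,\hat y)\frac{(\hat y-y)\otimes(\hat y-y)}{|\hat y-y|^3}\big(u(x,\hat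 y,t)-u(x,y,t)\big)d\hat y+b(x,y,t)$$ with $u(x,y,0)=u_0(x,y)$ and $\partial_tu(x,y,0)=v_0(x,y)$. Put $$u^H(x,t)=\int_Yu(x,y,t)\,dy,\qquad r(x,y,t)=u(x,y,t)-u^H(x,t).$$ Then for every measurable $V\subset\Omega$ with $|V|>0$ and every $t\in[0,T]$ the functions $u^\varepsilon(\cdot,t)$, $x\mapsto u(x,\tfrac x\varepsilon,t)$ and $u^H(\cdot,t)$ are integrable over $V$, and, as $\varepsilon\to0^+$, $$\lim_{\varepsilon\to0}\frac1{|V|}\int_Vu^\varepsilon(x,t)\,dx=\lim_{\varepsilon\to0}\frac1{|V|}\int_Vu\big(x,\tfrac x\varepsilon,t\big)\,dx=\frac1{|V|}\int_Vu^H(x,t)\,dx,\qquad \lim_{\varepsilon\to0}\frac1{|V|}\int_Vr\big(x,\tfrac x\varepsilon,t\big)\,dx=0.$$ -/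

import Mathlib

open MeasureTheory Set Filter Topology
open scoped ENNReal BoundedContinuousFunction

noncomputable section

/-- Three-dimensional Euclidean space. -/
abbrev E3 : Type := EuclideanSpace ℝ (Fin 3)

/-- The unit period cube `Y`, centred at the origin. -/
def unitCell : Set E3 := {y | ∀ i, -(1 / 2) ≤ y i ∧ y i < 1 / 2}

/-- The representative in `Y` of a point `y` modulo the lattice `ℤ³`. A function on `Y` is extended
`Y`-periodically to the whole space by composing it with this map. -/
def cellRep (y : E3) : E3 := WithLp.toLp 2 (fun i => Int.fract (y i + 1 / 2) - 1 / 2)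

/-- The geometry and the material parameters of a two-phase peridynamic medium. -/
structure PeridynamicMedium where
  /-- the body -/
  Ω : Set E3
  /-- the inclusion phase inside the unit cell; its periodic extension is the inclusion phase -/
  inclusion : Set E3
  /-- horizon and strength of the long range force -/
  γ : ℝ
  lam : ℝ
  /-- horizon and strengths of the short range force -/
  δ : ℝ
  Cf : ℝ
  Cm : ℝ
  Ci : ℝ
  /-- densities of the two phases -/
  ρf : ℝ
  ρm : ℝ
  isOpen_Ω : IsOpen Ω
  isBounded_Ω : Bornology.IsBounded Ω
  measurableSet_inclusion : MeasurableSet inclusion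
  γ_pos : 0 < γ
  lam_pos : 0 < lam
  δ_pos : 0 < δ
  Cf_pos : 0 < Cf
  Cm_pos : 0 < Cm
  Ci_pos : 0 < Ci
  ρf_pos : 0 < ρf
  ρm_pos : 0 < ρm

namespace PeridynamicMedium

open scoped Classical in
/-- The periodically extended indicator function of the inclusion phase. -/
def χf (M : PeridynamicMedium) (y : E3) : ℝ := if cellRep y ∈ M.inclusion then 1 else 0

/-- The periodically extended indicator function of the matrix phase. -/
def χm (M : PeridynamicMedium) (y : E3) : ℝ := 1 - M.χf y

/-- The periodic density `ρ`. -/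
def ρ (M : PeridynamicMedium) (y : E3) : ℝ := M.χf y * M.ρf + M.χm y * M.ρm

/-- The periodic bond strength `α` (the cut-off at the horizon is in the domains of integration
below). -/
def α (M : PeridynamicMedium) (y y' : E3) : ℝ :=
  M.Cf * (M.χf y * M.χf y') + M.Cm * (M.χm y * M.χm y')
    + M.Ci * (M.χf y * M.χm y' + M.χm y * M.χf y')

end PeridynamicMedium

/-- The vector `((ξ ⊗ ξ) / |ξ|³) η`. -/
def bondForce (ξ η : E3) : E3 := (‖ξ‖ ^ 3)⁻¹ • (inner ℝ ξ η • ξ)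

/-- The Banach space `L^p_per(Y; C(Ω̄)³)`. The closure of `Ω` is compact for a bounded `Ω`, so that
the bounded continuous functions on it are all the continuous ones. An element is an `L^p` class of
functions on `Y`; `TwoScaleField.eval` extends it periodically. -/
abbrev TwoScaleField (Ω : Set E3) (p : ℝ≥0∞) : Type :=
  Lp (closure Ω →ᵇ E3) p (volume.restrict unitCell)

/-- The space `L^p(Ω)³`. -/
abbrev BodyField (Ω : Set E3) (p : ℝ≥0∞) : Type := Lp E3 p (volume.restrict Ω)

namespace TwoScaleField

variable {Ω : Set E3} {p : ℝ≥0∞}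

open scoped Classical in
/-- The value `w(x, y)`, for `x` in the closure of `Ω` and any `y` in space, of the periodic
extension of `w` in the variable `y`. The value off the closure of `Ω` is `0` and plays no role. -/
def eval (w : TwoScaleField Ω p) (x y : E3) : E3 :=
  if h : x ∈ closure Ω then (w (cellRep y)) ⟨x, h⟩ else 0

/-- The rescaled field `x ↦ w(x, x/ε)`. -/
def rescale (ε : ℝ) (w : TwoScaleField Ω p) (x : E3) : E3 := w.eval x (ε⁻¹ • x)

/-- The macroscopic component `w^H(x) = ∫_Y w(x, y) dy`. -/
def macro_part (w : TwoScaleField Ω p) (x : E3) : E3 := ∫ y in unitCell, w.eval x y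

/-- The corrector `r(x, y) = w(x, y) - w^H(x)`. -/
def corrector (w : TwoScaleField Ω p) (x y : E3) : E3 := w.eval x y - w.macro_part x

end TwoScaleField

/-- `u ∈ C²([0,T]; L^p(Ω)³)` is the solution `u^ε` of the heterogeneous peridynamic initial value
problem at scale `ε`, with initial data `u₀(x, x/ε)`, `v₀(x, x/ε)` and body force `b(x, x/ε, t)`. -/
structure IsPeridynamicSolution (M : PeridynamicMedium) {p : ℝ≥0∞} [Fact (1 ≤ p)] (T : ℝ)
    (u₀ v₀ : TwoScaleField M.Ω p) (b : ℝ → TwoScaleField M.Ω p) (ε : ℝ)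
    (u : ℝ → BodyField M.Ω p) : Prop where
  contDiffOn : ContDiffOn ℝ 2 u (Icc 0 T)
  initial : ∀ᵐ x ∂(volume.restrict M.Ω), u 0 x = u₀.rescale ε x
  initial_deriv : ∀ᵐ x ∂(volume.restrict M.Ω),
    derivWithin u (Icc 0 T) 0 x = v₀.rescale ε x
  equation : ∀ t ∈ Icc 0 T, ∀ᵐ x ∂(volume.restrict M.Ω),
    M.ρ (ε⁻¹ • x) • iteratedDerivWithin 2 u (Icc 0 T) t x =
      (∫ x' in Metric.ball x M.γ ∩ M.Ω, M.lam • bondForce (x' - x) (u t x' - u t x))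
      + (∫ x' in Metric.ball x (ε * M.δ) ∩ M.Ω,
          ((ε ^ 2)⁻¹ * M.α (ε⁻¹ • x) (ε⁻¹ • x')) • bondForce (x' - x) (u t x' - u t x))
      + (b t).rescale ε x

/-- `u ∈ C²([0,T]; L^p_per(Y; C(Ω̄)³))` is the solution of the two-scale peridynamic initial value
problem. The equation is one between elements of `L^p_per(Y; C(Ω̄)³)`: it holds for almost every `y`
and, for such `y`, for every `x`. -/
structure IsTwoScaleSolution (M : PeridynamicMedium) {p : ℝ≥0∞} [Fact (1 ≤ p)] (T : ℝ)
    (u₀ v₀ : TwoScaleField M.Ω p) (b : ℝ → TwoScaleField M.Ω p)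
    (u : ℝ → TwoScaleField M.Ω p) : Prop where
  contDiffOn : ContDiffOn ℝ 2 u (Icc 0 T)
  initial : u 0 = u₀
  initial_deriv : derivWithin u (Icc 0 T) 0 = v₀
  equation : ∀ t ∈ Icc 0 T, ∀ᵐ y ∂(volume.restrict unitCell), ∀ x ∈ closure M.Ω,
    M.ρ y • TwoScaleField.eval (iteratedDerivWithin 2 u (Icc 0 T) t) x y =
      (∫ x' in Metric.ball x M.γ ∩ M.Ω,
          M.lam • bondForce (x' - x) ((u t).macro_part x' - (u t).eval x y))
      + (∫ y' in Metric.ball y M.δ,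
          M.α y y' • bondForce (y' - y) ((u t).eval x y' - (u t).eval x y))
      + (b t).eval x y

end

noncomputable section

/-! ### The bond force and its kernel -/

/-! The claim concerns integrals over `V`, so it is enough to compare `u^ε(x,t)` with `u(x,x/ε,t)`
in `L¹(Ω)` and then to average the rescaled field.

Evaluate the two-scale equation at `y = x/ε`. By lattice periodicity and a dilation, its integral
over the `δ`-ball about `y` becomes the integral over the `εδ`-ball about `x` with the factor `ε⁻²`
(`integral_ball_cellRep_eq_bondIntegral`). Hence the rescaled field solves the heterogeneous
equation up to a residual with three terms: the oscillation `u(x',x'/ε) - u^H(x')` in the long range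
force, the slow difference `u(x',x'/ε) - u(x,x'/ε)` in the short range force, and the short range
bonds that leave `Ω`.

All bond operators are controlled by the kernel `|ξ|⁻¹`, whose mass on a ball of radius `r` is a
multiple of `r²`. For `r = εδ` this cancels the factor `ε⁻²`, so the operators are bounded in `L¹`
uniformly in `ε`. On the fields `1_s(y) φ(x)` the residual tends to zero: the oscillation by weak
convergence of rescaled periodic indicators (`tendsto_integral_rescale_indicator`), the slow
difference by continuity of `φ`, and the boundary term because it eventually vanishes at each point
of the open set `Ω`. Density and the uniform bound extend this to every two-scale field
(`exists_residual`), and the convergence is uniform on the compact trajectory `u([0,T])`.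

The error has zero initial data, and its second derivative is bounded by a multiple of the error
plus a multiple of the residual (`norm_error_deriv_le`). Gronwall's inequality therefore makes it
vanish in `L¹` (`tendsto_error_zero`). The averages of the rescaled field converge by the same
density argument and the same weak convergence (`tendsto_setIntegral_rescale_sub_macro`). -/

theorem bondForce_add (ξ η₁ η₂ : E3) :
    bondForce ξ (η₁ + η₂) = bondForce ξ η₁ + bondForce ξ η₂ := by
  simp [bondForce, inner_add_right, add_smul]

theorem bondForce_sub (ξ η₁ η₂ : E3) :
    bondForce ξ (η₁ - η₂) = bondForce ξ η₁ - bondForce ξ η₂ := by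
  simp [bondForce, inner_sub_right, sub_smul, smul_sub]

theorem bondForce_smul (ξ : E3) (c : ℝ) (η : E3) :
    bondForce ξ (c • η) = c • bondForce ξ η := by
  simp only [bondForce, inner_smul_right, smul_smul]
  congr 1; ring

/-- Homogeneity of degree `-1`: together with the Jacobian `ε⁻³` of the dilation it produces the
factor `ε⁻²` of the short range force. -/
theorem bondForce_smul_left {c : ℝ} (hc : 0 < c) (ξ η : E3) :
    bondForce (c • ξ) η = c⁻¹ • bondForce ξ η := by
  simp only [bondForce, norm_smul, inner_smul_left, smul_smul, Real.norm_of_nonneg hc.le]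
  congr 1
  simp
  field_simp

theorem norm_bondForce_le (ξ η : E3) : ‖bondForce ξ η‖ ≤ ‖ξ‖⁻¹ * ‖η‖ := by
  rcases eq_or_ne ξ 0 with rfl | hξ
  · simp [bondForce]
  have h : 0 < ‖ξ‖ := norm_pos_iff.2 hξ
  rw [bondForce, norm_smul, norm_smul, norm_inv, norm_pow, norm_norm]
  calc (‖ξ‖ ^ 3)⁻¹ * (‖inner ℝ ξ η‖ * ‖ξ‖) ≤ (‖ξ‖ ^ 3)⁻¹ * ((‖ξ‖ * ‖η‖) * ‖ξ‖) := by
        gcongr; exact norm_inner_le_norm ξ η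
    _ = ‖ξ‖⁻¹ * ‖η‖ := by field_simp

theorem Measurable.bondForce {X : Type*} [MeasurableSpace X] {f g : X → E3} (hf : Measurable f)
    (hg : Measurable g) : Measurable fun q => bondForce (f q) (g q) := by
  unfold _root_.bondForce
  fun_prop

/-- The weakly singular kernel `|ξ|⁻¹`, cut off at the radius `r`. -/
def rieszKernel (r : ℝ) (ξ : E3) : ℝ≥0∞ :=
  (Metric.ball (0 : E3) r).indicator (fun ξ => ENNReal.ofReal ‖ξ‖⁻¹) ξ

/-- The mass of the unit weakly singular kernel. -/
def rieszMass : ℝ≥0∞ := ∫⁻ ξ, rieszKernel 1 ξ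

theorem measurable_rieszKernel (r : ℝ) : Measurable (rieszKernel r) :=
  Measurable.indicator (by fun_prop) Metric.isOpen_ball.measurableSet

theorem measurable_rieszKernel_sub (r : ℝ) (x : E3) :
    Measurable fun x' => rieszKernel r (x' - x) :=
  (measurable_rieszKernel r).comp (measurable_id.sub_const x)

theorem measurable_rieszKernel_sub' (r : ℝ) (x' : E3) :
    Measurable fun x => rieszKernel r (x' - x) :=
  (measurable_rieszKernel r).comp (measurable_id.const_sub x')

theorem measurable_rieszKernel_prod (r : ℝ) :
    Measurable fun q : E3 × E3 => rieszKernel r (q.2 - q.1) :=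
  (measurable_rieszKernel r).comp (measurable_snd.sub measurable_fst)

theorem rieszKernel_neg (r : ℝ) (ξ : E3) : rieszKernel r (-ξ) = rieszKernel r ξ := by
  simp [rieszKernel, indicator]

/-- In polar coordinates the weight `s²` of dimension three turns the radial profile `s⁻¹` into `s`.
-/
theorem integrableOn_inv_norm_ball (r : ℝ) :
    IntegrableOn (fun ξ : E3 => ‖ξ‖⁻¹) (Metric.ball 0 r) := by
  rw [integrableOn_fun_norm_addHaar volume (f := fun s : ℝ => s⁻¹)]
  have : IntegrableOn (fun s : ℝ => s) (Ioo 0 r) :=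
    (continuous_id.integrableOn_Icc (a := 0) (b := r)).mono_set Ioo_subset_Icc_self
  refine this.congr_fun (fun s hs => ?_) measurableSet_Ioo
  have := hs.1.ne'
  simp only [finrank_euclideanSpace, Fintype.card_fin, smul_eq_mul]
  field_simp

theorem lintegral_rieszKernel_eq_ofReal (r : ℝ) :
    ∫⁻ ξ, rieszKernel r ξ = ENNReal.ofReal (∫ ξ in Metric.ball (0 : E3) r, ‖ξ‖⁻¹) := by
  unfold rieszKernel
  rw [lintegral_indicator Metric.isOpen_ball.measurableSet,
    ofReal_integral_eq_lintegral_ofReal (integrableOn_inv_norm_ball r)]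
  exact ae_of_all _ fun _ => by positivity

theorem rieszMass_ne_top : rieszMass ≠ ∞ := by
  rw [rieszMass, lintegral_rieszKernel_eq_ofReal]; exact ENNReal.ofReal_ne_top

/-- Dilation by `r` gives `r³` from the volume and `r⁻¹` from the kernel. The resulting `r²` is what
absorbs `ε⁻²` when `r = εδ`. -/
theorem lintegral_rieszKernel {r : ℝ} (hr : 0 < r) :
    ∫⁻ ξ, rieszKernel r ξ = ENNReal.ofReal (r ^ 2) * rieszMass := by
  rw [rieszMass, lintegral_rieszKernel_eq_ofReal, lintegral_rieszKernel_eq_ofReal,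
    ← ENNReal.ofReal_mul (by positivity)]
  congr 1
  have h := Measure.setIntegral_comp_smul_of_pos volume (fun ξ : E3 => ‖ξ‖⁻¹)
    (Metric.ball 0 1) hr
  rw [smul_unitBall_of_pos hr, finrank_euclideanSpace, Fintype.card_fin, smul_eq_mul] at h
  simp only [norm_smul, Real.norm_of_nonneg hr.le, mul_inv] at h
  rw [integral_const_mul] at h
  field_simp at h
  simpa only [one_div] using h.symm

/-- Tonelli in the form of Schur's test: the even kernel has the same mass in either variable, so
each of the two summands contributes once. -/
theorem lintegral_rieszKernel_conv {r : ℝ} (hr : 0 < r) {h : E3 → ℝ≥0∞} (hh : Measurable h) :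
    ∫⁻ x, ∫⁻ x', rieszKernel r (x' - x) * (h x + h x')
      = 2 * (ENNReal.ofReal (r ^ 2) * rieszMass) * ∫⁻ x, h x := by
  have hk := measurable_rieszKernel_prod r
  have hk1 : ∀ x, ∫⁻ x', rieszKernel r (x' - x) = ENNReal.ofReal (r ^ 2) * rieszMass := by
    intro x
    rw [← lintegral_rieszKernel hr, lintegral_sub_right_eq_self (rieszKernel r) x]
  have hk2 : ∀ x', ∫⁻ x, rieszKernel r (x' - x) = ENNReal.ofReal (r ^ 2) * rieszMass := by
    intro x
    rw [← hk1 x]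
    exact lintegral_congr fun y => by rw [← rieszKernel_neg, neg_sub]
  have hm1 : Measurable fun q : E3 × E3 => rieszKernel r (q.2 - q.1) * h q.1 :=
    hk.mul (hh.comp measurable_fst)
  have hm2 : Measurable fun q : E3 × E3 => rieszKernel r (q.2 - q.1) * h q.2 :=
    hk.mul (hh.comp measurable_snd)
  calc ∫⁻ x, ∫⁻ x', rieszKernel r (x' - x) * (h x + h x')
      = ∫⁻ x, ((∫⁻ x', rieszKernel r (x' - x) * h x) + ∫⁻ x', rieszKernel r (x' - x) * h x') := by
        refine lintegral_congr fun x => ?_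
        simp_rw [mul_add]
        exact lintegral_add_left (hm1.comp measurable_prodMk_left) _
    _ = (∫⁻ x, ∫⁻ x', rieszKernel r (x' - x) * h x)
          + ∫⁻ x, ∫⁻ x', rieszKernel r (x' - x) * h x' :=
        lintegral_add_left hm1.lintegral_prod_right' _
    _ = (∫⁻ x, ∫⁻ x', rieszKernel r (x' - x) * h x)
          + ∫⁻ x', ∫⁻ x, rieszKernel r (x' - x) * h x' := by
        congr 1
        exact lintegral_lintegral_swap hm2.aemeasurable
    _ = _ := by
        have e1 : ∀ x, ∫⁻ x', rieszKernel r (x' - x) * h x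
            = ENNReal.ofReal (r ^ 2) * rieszMass * h x := fun x => by
          rw [lintegral_mul_const _ (measurable_rieszKernel_sub r x), hk1]
        have e2 : ∀ x', ∫⁻ x, rieszKernel r (x' - x) * h x'
            = ENNReal.ofReal (r ^ 2) * rieszMass * h x' := fun x' => by
          rw [lintegral_mul_const _ (measurable_rieszKernel_sub' r x'), hk2]
        simp_rw [e1, e2]
        rw [lintegral_const_mul _ hh]
        ring

/-- A bounded measurable bond kernel of horizon `r`. -/
structure IsBondKernel (κ : E3 → E3 → ℝ) (Λ r : ℝ) : Prop where
  measurable : Measurable (Function.uncurry κ)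
  abs_le : ∀ x x', |κ x x'| ≤ Λ
  eq_zero : ∀ x x', r ≤ ‖x' - x‖ → κ x x' = 0

/-- The bond integrand. -/
def bondIntegrand (κ : E3 → E3 → ℝ) (f : E3 → E3 → E3) (x x' : E3) : E3 :=
  κ x x' • bondForce (x' - x) (f x x')

/-- The bond integral. -/
def bondIntegral (κ : E3 → E3 → ℝ) (f : E3 → E3 → E3) (x : E3) : E3 :=
  ∫ x', bondIntegrand κ f x x'

namespace IsBondKernel

variable {κ : E3 → E3 → ℝ} {Λ r : ℝ} {f : E3 → E3 → E3}

theorem enorm_bondIntegrand_le (hκ : IsBondKernel κ Λ r) (x x' : E3) :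
    ‖bondIntegrand κ f x x'‖ₑ ≤ ENNReal.ofReal Λ * (rieszKernel r (x' - x) * ‖f x x'‖ₑ) := by
  by_cases h : ‖x' - x‖ < r
  · have hb : x' - x ∈ Metric.ball (0 : E3) r := by simpa using h
    rw [rieszKernel, indicator_of_mem hb, ← ofReal_norm, ← ofReal_norm,
      ← ENNReal.ofReal_mul (by positivity),
      ← ENNReal.ofReal_mul ((abs_nonneg _).trans (hκ.abs_le x x'))]
    refine ENNReal.ofReal_le_ofReal ?_
    rw [bondIntegrand, norm_smul]
    exact mul_le_mul (hκ.abs_le x x') (norm_bondForce_le _ _) (norm_nonneg _)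
      ((abs_nonneg _).trans (hκ.abs_le x x'))
  · simp [bondIntegrand, hκ.eq_zero x x' (not_lt.1 h)]

theorem measurable_bondIntegrand (hκ : IsBondKernel κ Λ r) (hf : Measurable (Function.uncurry f)) :
    Measurable (Function.uncurry (bondIntegrand κ f)) := by
  have h2 : Measurable fun q : E3 × E3 => bondForce (q.2 - q.1) (Function.uncurry f q) :=
    (measurable_snd.sub measurable_fst).bondForce hf
  exact hκ.measurable.smul h2

theorem measurable_bondIntegral (hκ : IsBondKernel κ Λ r) (hf : Measurable (Function.uncurry f)) :
    Measurable (bondIntegral κ f) :=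
  ((hκ.measurable_bondIntegrand hf).stronglyMeasurable.integral_prod_right).measurable

theorem enorm_bondIntegrand_le_add (hκ : IsBondKernel κ Λ r) {x x' : E3} {h : E3 → ℝ≥0∞}
    (hfh : κ x x' ≠ 0 → ‖f x x'‖ₑ ≤ h x + h x') :
    ‖bondIntegrand κ f x x'‖ₑ ≤ ENNReal.ofReal Λ * (rieszKernel r (x' - x) * (h x + h x')) := by
  by_cases hk : κ x x' = 0
  · simp [bondIntegrand, hk]
  · refine (hκ.enorm_bondIntegrand_le x x').trans ?_
    gcongr
    exact hfh hk

/-- The basic `L¹` estimate. The majorant is required only on bonds that start in `S` and carry a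
nonzero kernel, since fields on the body are controlled nowhere else. -/
theorem lintegral_enorm_bondIntegrand_le (hκ : IsBondKernel κ Λ r) (hr : 0 < r) {S : Set E3}
    (hS : MeasurableSet S) {h : E3 → ℝ≥0∞} (hh : Measurable h)
    (hfh : ∀ x ∈ S, ∀ x', κ x x' ≠ 0 → ‖f x x'‖ₑ ≤ h x + h x') :
    ∫⁻ x in S, ∫⁻ x', ‖bondIntegrand κ f x x'‖ₑ
      ≤ 2 * (ENNReal.ofReal (Λ * r ^ 2) * rieszMass) * ∫⁻ x, h x := by
  have hm : Measurable fun q : E3 × E3 => rieszKernel r (q.2 - q.1) * (h q.1 + h q.2) :=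
    (measurable_rieszKernel_prod r).mul
      ((hh.comp measurable_fst).add (hh.comp measurable_snd))
  have hm1 (x : E3) : Measurable fun x' => rieszKernel r (x' - x) * (h x + h x') :=
    (measurable_rieszKernel_sub r x).mul (hh.const_add _)
  have hm2 : Measurable fun x => ∫⁻ x', rieszKernel r (x' - x) * (h x + h x') :=
    hm.lintegral_prod_right'
  have hΛ : 0 ≤ Λ := (abs_nonneg _).trans (hκ.abs_le 0 0)
  calc ∫⁻ x in S, ∫⁻ x', ‖bondIntegrand κ f x x'‖ₑ
      ≤ ∫⁻ x in S, ∫⁻ x', ENNReal.ofReal Λ * (rieszKernel r (x' - x) * (h x + h x')) :=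
        setLIntegral_mono' hS fun x hx =>
          lintegral_mono fun x' => hκ.enorm_bondIntegrand_le_add (hfh x hx x')
    _ ≤ ∫⁻ x, ∫⁻ x', ENNReal.ofReal Λ * (rieszKernel r (x' - x) * (h x + h x')) :=
        setLIntegral_le_lintegral _ _
    _ = ENNReal.ofReal Λ * ∫⁻ x, ∫⁻ x', rieszKernel r (x' - x) * (h x + h x') := by
        rw [← lintegral_const_mul _ hm2]
        exact lintegral_congr fun x => lintegral_const_mul _ (hm1 x)
    _ = _ := by
        rw [lintegral_rieszKernel_conv hr hh, ENNReal.ofReal_mul hΛ]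
        ring

theorem lintegral_enorm_bondIntegral_le (hκ : IsBondKernel κ Λ r) (hr : 0 < r) {S : Set E3}
    (hS : MeasurableSet S) {h : E3 → ℝ≥0∞} (hh : Measurable h)
    (hfh : ∀ x ∈ S, ∀ x', κ x x' ≠ 0 → ‖f x x'‖ₑ ≤ h x + h x') :
    ∫⁻ x in S, ‖bondIntegral κ f x‖ₑ
      ≤ 2 * (ENNReal.ofReal (Λ * r ^ 2) * rieszMass) * ∫⁻ x, h x :=
  (lintegral_mono fun _ => enorm_integral_le_lintegral_enorm _).trans
    (hκ.lintegral_enorm_bondIntegrand_le hr hS hh hfh)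

theorem ae_integrable_bondIntegrand (hκ : IsBondKernel κ Λ r) (hr : 0 < r) {S : Set E3}
    (hS : MeasurableSet S) (hf : Measurable (Function.uncurry f)) {h : E3 → ℝ≥0∞}
    (hh : Measurable h) (hh' : ∫⁻ x, h x ≠ ∞)
    (hfh : ∀ x ∈ S, ∀ x', κ x x' ≠ 0 → ‖f x x'‖ₑ ≤ h x + h x') :
    ∀ᵐ x ∂(volume.restrict S), Integrable (bondIntegrand κ f x) := by
  have hm := hκ.measurable_bondIntegrand hf
  have hlt : ∫⁻ x in S, ∫⁻ x', ‖bondIntegrand κ f x x'‖ₑ ≠ ∞ := by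
    refine ne_top_of_le_ne_top ?_ (hκ.lintegral_enorm_bondIntegrand_le hr hS hh hfh)
    have := rieszMass_ne_top
    finiteness
  have hae := ae_lt_top (hm.enorm.lintegral_prod_right') hlt
  filter_upwards [hae] with x hx
  exact ⟨(hm.comp measurable_prodMk_left).aestronglyMeasurable, hx⟩

/-- A pointwise bound, for bounded differences. -/
theorem lintegral_enorm_bondIntegrand_le_const (hκ : IsBondKernel κ Λ r) (hr : 0 < r) (x : E3)
    {c : ℝ≥0∞} (hfc : ∀ᵐ x', κ x x' ≠ 0 → ‖f x x'‖ₑ ≤ c) :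
    ∫⁻ x', ‖bondIntegrand κ f x x'‖ₑ ≤ ENNReal.ofReal (Λ * r ^ 2) * rieszMass * c := by
  have hΛ : 0 ≤ Λ := (abs_nonneg _).trans (hκ.abs_le 0 0)
  calc ∫⁻ x', ‖bondIntegrand κ f x x'‖ₑ
      ≤ ∫⁻ x', ENNReal.ofReal Λ * c * rieszKernel r (x' - x) := by
        refine lintegral_mono_ae ?_
        filter_upwards [hfc] with x' hx'
        by_cases hk : κ x x' = 0
        · simp [bondIntegrand, hk]
        · refine (hκ.enorm_bondIntegrand_le x x').trans ?_
          rw [mul_assoc, mul_comm c]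
          gcongr
          exact hx' hk
    _ = _ := by
        rw [lintegral_const_mul _ (measurable_rieszKernel_sub r x),
          lintegral_sub_right_eq_self (rieszKernel r) x, lintegral_rieszKernel hr,
          ENNReal.ofReal_mul hΛ]
        ring

theorem integrable_bondIntegrand_of_bounded (hκ : IsBondKernel κ Λ r) (hr : 0 < r) (x : E3)
    (hf : Measurable (Function.uncurry f)) {c : ℝ≥0∞} (hc : c ≠ ∞) (hfc : ∀ x', ‖f x x'‖ₑ ≤ c) :
    Integrable (bondIntegrand κ f x) := by
  have := rieszMass_ne_top
  exact ⟨(hκ.measurable_bondIntegrand hf).of_uncurry_left.aestronglyMeasurable,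
    (hκ.lintegral_enorm_bondIntegrand_le_const hr x (ae_of_all _ fun x' _ => hfc x')).trans_lt
      (by finiteness)⟩

end IsBondKernel

/-! ### The unit cell and periodicity -/

theorem measurable_toLp_E3 {X : Type*} [MeasurableSpace X] {f : X → Fin 3 → ℝ}
    (hf : Measurable f) : Measurable fun x => (WithLp.toLp 2 (f x) : E3) :=
  (PiLp.continuous_toLp 2 (fun _ : Fin 3 => ℝ)).measurable.comp hf

theorem measurable_apply_E3 (i : Fin 3) : Measurable fun y : E3 => y i :=
  (PiLp.continuous_apply 2 (fun _ : Fin 3 => ℝ) i).measurable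

theorem measurable_cellRep : Measurable cellRep :=
  measurable_toLp_E3 <| measurable_pi_iff.2 fun i =>
    (measurable_fract.comp ((measurable_apply_E3 i).add_const _)).sub_const _

theorem measurableSet_unitCell : MeasurableSet unitCell := by
  simp only [unitCell, ofPred_forall, ofPred_and]
  exact MeasurableSet.iInter fun i =>
    (measurableSet_le measurable_const (measurable_apply_E3 i)).inter
      (measurableSet_lt (measurable_apply_E3 i) measurable_const)

theorem volume_unitCell : volume unitCell = 1 := by
  have h : unitCell = (WithLp.ofLp : E3 → Fin 3 → ℝ) ⁻¹'
      (Set.pi univ fun _ => Ico (-(1 / 2)) (1 / 2)) := by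
    ext y; simp [unitCell]
  rw [h, (PiLp.volume_preserving_ofLp (Fin 3)).measure_preimage
    (MeasurableSet.univ_pi fun _ => measurableSet_Ico).nullMeasurableSet, volume_pi_pi]
  simp
  norm_num

instance : IsProbabilityMeasure (volume.restrict unitCell) :=
  ⟨by rw [Measure.restrict_apply_univ, volume_unitCell]⟩

theorem norm_le_one_of_mem_unitCell {y : E3} (hy : y ∈ unitCell) : ‖y‖ ≤ 1 := by
  rw [EuclideanSpace.norm_eq]
  refine Real.sqrt_le_one.2 ?_
  have h : ∀ i, ‖y i‖ ^ 2 ≤ 1 / 4 := fun i => by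
    have := hy i
    rw [Real.norm_eq_abs, sq_abs]
    nlinarith
  rw [Fin.sum_univ_three]
  linarith [h 0, h 1, h 2]

theorem cellRep_mem (y : E3) : cellRep y ∈ unitCell := fun i => by
  have h1 := Int.fract_nonneg (y i + 1 / 2)
  have h2 := Int.fract_lt_one (y i + 1 / 2)
  simp only [cellRep]
  constructor <;> linarith

theorem cellRep_of_mem {y : E3} (hy : y ∈ unitCell) : cellRep y = y := by
  ext i
  have := hy i
  simp only [cellRep]
  rw [Int.fract_eq_self.2 ⟨by linarith, by linarith⟩]
  ring

/-- The vectors of the period lattice. -/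
def latticeVec : (Fin 3 → ℤ) →+ E3 where
  toFun k := WithLp.toLp 2 fun i => (k i : ℝ)
  map_zero' := by ext; simp
  map_add' k l := by ext; simp

theorem cellRep_add_latticeVec (y : E3) (k : Fin 3 → ℤ) :
    cellRep (y + latticeVec k) = cellRep y := by
  ext i
  simp only [cellRep, latticeVec, AddMonoidHom.coe_mk, ZeroHom.coe_mk, PiLp.add_apply]
  rw [add_right_comm, Int.fract_add_intCast]

theorem exists_cellRep_eq_add (y : E3) : ∃ k, cellRep y = y + latticeVec k := by
  refine ⟨fun i => -⌊y i + 1 / 2⌋, ?_⟩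
  ext i
  simp only [cellRep, latticeVec, AddMonoidHom.coe_mk, ZeroHom.coe_mk, PiLp.add_apply, Int.fract]
  push_cast
  ring

theorem cellRep_cellRep (y : E3) : cellRep (cellRep y) = cellRep y := cellRep_of_mem (cellRep_mem y)

/-- Every translate of the unit cell is a fundamental domain of the period lattice. -/
theorem isAddFundamentalDomain_translate (a : E3) :
    IsAddFundamentalDomain latticeVec.range {y | y - a ∈ unitCell} (volume : Measure E3) := by
  refine IsAddFundamentalDomain.mk'
    (measurableSet_unitCell.preimage (measurable_id.sub_const a)).nullMeasurableSet fun x => ?_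
  obtain ⟨k, hk⟩ := exists_cellRep_eq_add (x - a)
  refine ⟨⟨latticeVec k, k, rfl⟩, ?_, ?_⟩
  · change latticeVec k + x - a ∈ unitCell
    rw [show latticeVec k + x - a = x - a + latticeVec k by abel, ← hk]
    exact cellRep_mem _
  · rintro ⟨_, l, rfl⟩ hl
    change latticeVec l + x - a ∈ unitCell at hl
    have h := cellRep_of_mem hl
    rw [show latticeVec l + x - a = x - a + latticeVec l by abel, cellRep_add_latticeVec, hk] at h
    exact Subtype.ext (add_left_cancel h.symm)

theorem isAddFundamentalDomain_unitCell :
    IsAddFundamentalDomain latticeVec.range unitCell (volume : Measure E3) := by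
  simpa using isAddFundamentalDomain_translate 0

theorem countable_latticeVec_range : Countable latticeVec.range :=
  (Set.countable_range latticeVec).to_subtype

/-- A periodic function has the same integral over any two fundamental domains, here the cell and
its translate by `a`. -/
theorem lintegral_unitCell_add (N : E3 → ℝ≥0∞) (a : E3) :
    ∫⁻ z in unitCell, N (cellRep (a + z)) = ∫⁻ z in unitCell, N z := by
  have := countable_latticeVec_range
  have h1 : ∫⁻ z in unitCell, N (cellRep (a + z))
      = ∫⁻ y in {y | y - a ∈ unitCell}, N (cellRep y) := by
    have := (measurePreserving_add_left volume a).setLIntegral_comp_preimage_emb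
      (MeasurableEquiv.addLeft a).measurableEmbedding (fun y => N (cellRep y))
      {y | y - a ∈ unitCell}
    rw [← this]
    congr 2
    ext z; simp
  rw [h1, (isAddFundamentalDomain_translate a).setLIntegral_eq isAddFundamentalDomain_unitCell]
  · exact setLIntegral_congr_fun measurableSet_unitCell fun y hy => by
      simp only [cellRep_of_mem hy]
  · rintro ⟨_, l, rfl⟩ x
    change N (cellRep (latticeVec l + x)) = _
    rw [add_comm, cellRep_add_latticeVec]

theorem integral_unitCell_indicator_cellRep {E : Set E3} (hE : MeasurableSet E) (a : E3) :
    ∫ z in unitCell, (E.indicator (fun _ => (1 : ℝ)) (cellRep (a + z)))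
      = (volume.restrict unitCell).real E := by
  have hm : Measurable fun z => cellRep (a + z) :=
    measurable_cellRep.comp (measurable_id.const_add a)
  have h : (fun z => E.indicator (fun _ => (1 : ℝ)) (cellRep (a + z)))
      = ((fun z => cellRep (a + z)) ⁻¹' E).indicator 1 := by
    rfl
  rw [h, integral_indicator_one (hm hE), Measure.real, Measure.real]
  congr 1
  have := lintegral_unitCell_add (E.indicator 1) a
  rw [lintegral_indicator_one hE, ← lintegral_indicator_one (hm hE)] at *
  exact this

/-- The cell averages of a rescaled periodic function are uniformly bounded. -/
theorem lintegral_ball_rescale_le {N : E3 → ℝ≥0∞} (hN : Measurable N) {R ε : ℝ} (hε : 0 < ε) :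
    ∫⁻ x in Metric.ball (0 : E3) R, N (cellRep (ε⁻¹ • x))
      ≤ volume (Metric.ball (0 : E3) (R + ε)) * ∫⁻ z in unitCell, N z := by
  set B := Metric.ball (0 : E3) R
  set B' := Metric.ball (0 : E3) (R + ε)
  have hB : MeasurableSet B := Metric.isOpen_ball.measurableSet
  have hB' : MeasurableSet B' := Metric.isOpen_ball.measurableSet
  -- Shifting `x` by `εz` moves it by at most `ε`, because the cell has radius below one. Averaging
  -- this bound over `z` replaces the oscillating function by its cell mean.
  have key : ∀ z ∈ unitCell, ∫⁻ x in B, N (cellRep (ε⁻¹ • x))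
      ≤ ∫⁻ x in B', N (cellRep (ε⁻¹ • x + z)) := by
    intro z hz
    rw [← lintegral_indicator hB, ← lintegral_indicator hB',
      ← lintegral_add_right_eq_self (fun x => B.indicator (fun x => N (cellRep (ε⁻¹ • x))) x)
        (ε • z)]
    refine lintegral_mono fun x => ?_
    by_cases hx : x + ε • z ∈ B
    · have hx' : x ∈ B' := by
        have h1 : ‖x + ε • z‖ < R := by simpa [B] using hx
        have h2 : ‖ε • z‖ ≤ ε := by
          rw [norm_smul, Real.norm_of_nonneg hε.le]
          exact mul_le_of_le_one_right hε.le (norm_le_one_of_mem_unitCell hz)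
        have h3 : ‖x‖ ≤ ‖x + ε • z‖ + ‖ε • z‖ := by
          simpa using norm_sub_le (x + ε • z) (ε • z)
        simp only [B', mem_ball_zero_iff]
        linarith
      rw [indicator_of_mem hx, indicator_of_mem hx', smul_add, smul_smul, inv_mul_cancel₀ hε.ne',
        one_smul]
    · rw [indicator_of_notMem hx]
      exact zero_le
  have hm : Measurable (Function.uncurry fun z x : E3 => N (cellRep (ε⁻¹ • x + z))) :=
    hN.comp (measurable_cellRep.comp ((measurable_snd.const_smul ε⁻¹).add measurable_fst))
  calc ∫⁻ x in B, N (cellRep (ε⁻¹ • x))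
      = ∫⁻ z in unitCell, ∫⁻ x in B, N (cellRep (ε⁻¹ • x)) := by
        rw [setLIntegral_const, volume_unitCell, mul_one]
    _ ≤ ∫⁻ z in unitCell, ∫⁻ x in B', N (cellRep (ε⁻¹ • x + z)) :=
        setLIntegral_mono' measurableSet_unitCell key
    _ = ∫⁻ x in B', ∫⁻ z in unitCell, N (cellRep (ε⁻¹ • x + z)) :=
        lintegral_lintegral_swap hm.aemeasurable
    _ = _ := by
        simp_rw [lintegral_unitCell_add]
        rw [setLIntegral_const, mul_comm]

/-- The preceding bound, applied to the indicator of an exceptional null set, shows that its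
rescaled periodic copies are null in every ball. This makes statements about classes on the cell
usable at `y = x/ε`. -/
theorem ae_cellRep_of_ae {P : E3 → Prop} (hP : ∀ᵐ y ∂(volume.restrict unitCell), P y) {ε : ℝ}
    (hε : 0 < ε) : ∀ᵐ x : E3, P (cellRep (ε⁻¹ • x)) := by
  obtain ⟨s, hs, hsm, hs0⟩ := exists_measurable_superset_of_null (ae_iff.1 hP)
  have hN : Measurable (s.indicator (1 : E3 → ℝ≥0∞)) := measurable_one.indicator hsm
  have hm : Measurable fun x : E3 => s.indicator (1 : E3 → ℝ≥0∞) (cellRep (ε⁻¹ • x)) :=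
    hN.comp (measurable_cellRep.comp (measurable_id.const_smul ε⁻¹))
  have h1 : ∀ n : ℕ, ∀ᵐ x, x ∈ Metric.ball (0 : E3) n →
      s.indicator (1 : E3 → ℝ≥0∞) (cellRep (ε⁻¹ • x)) = 0 := fun n => by
    have h := lintegral_ball_rescale_le hN (R := n) hε
    rw [lintegral_indicator_one hsm, hs0, mul_zero, nonpos_iff_eq_zero,
      lintegral_eq_zero_iff hm] at h
    exact (ae_restrict_iff' Metric.isOpen_ball.measurableSet).1 h
  filter_upwards [ae_all_iff.2 h1] with x hx
  obtain ⟨n, hn⟩ := exists_nat_gt ‖x‖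
  have h2 := hx n (by simpa using hn)
  by_contra hc
  rw [indicator_of_mem (hs hc)] at h2
  exact one_ne_zero h2

/-! ### Weak convergence of rescaled periodic indicators -/

/-- Continuity of translations in `L¹`, read off from the continuous action of the additive group on
`Lp`. -/
theorem tendsto_lintegral_enorm_translate_sub {g : E3 → E3} (hg : Integrable g) :
    Tendsto (fun h : E3 => ∫⁻ x, ‖g (h + x) - g x‖ₑ) (𝓝 0) (𝓝 0) := by
  have : Fact ((1 : ℝ≥0∞) ≠ ∞) := ⟨ENNReal.one_ne_top⟩
  have hg1 : MemLp g 1 := memLp_one_iff_integrable.2 hg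
  have hc : Continuous fun h : E3 => DomAddAct.mk h +ᵥ hg1.toLp g :=
    (show Continuous fun h : E3 => DomAddAct.mk h from DomAddAct.continuous_mk).vadd
      continuous_const
  have h0 : DomAddAct.mk (0 : E3) +ᵥ hg1.toLp g = hg1.toLp g := by
    rw [DomAddAct.mk_zero, zero_vadd]
  have ht : Tendsto (fun h : E3 => edist (DomAddAct.mk h +ᵥ hg1.toLp g) (hg1.toLp g))
      (𝓝 0) (𝓝 0) := by
    have := (hc.tendsto 0).edist (tendsto_const_nhds (x := hg1.toLp g))
    rwa [h0, edist_self] at this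
  refine ht.congr fun h => ?_
  rw [DomAddAct.mk_vadd_toLp, Lp.edist_toLp_toLp, eLpNorm_one_eq_lintegral_enorm]
  rfl

/-- Translate the integral by `εz` and average over `z` in the cell. If `g` were unaffected by the
shift, the periodic factor would average to the measure of `E` exactly, so the error is at most the
mean `L¹` modulus of continuity of `g` at distances up to `ε`. -/
theorem tendsto_integral_rescale_indicator {E : Set E3} (hE : MeasurableSet E) {g : E3 → E3}
    (hg : Integrable g) :
    Tendsto (fun ε : ℝ => ∫ x, E.indicator (fun _ => (1 : ℝ)) (cellRep (ε⁻¹ • x)) • g x)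
      (𝓝[>] 0) (𝓝 ((volume.restrict unitCell).real E • ∫ x, g x)) := by
  set m : E3 → ℝ := fun y => E.indicator (fun _ => (1 : ℝ)) (cellRep y) with hm
  have hmm : Measurable m := (measurable_const.indicator hE).comp measurable_cellRep
  have hm1 : ∀ y, ‖m y‖ ≤ 1 := fun y => by
    simp only [hm, indicator]; split_ifs <;> simp
  set μY := (volume : Measure E3).restrict unitCell with hμY
  have key : ∀ ε : ℝ, 0 < ε →
      ‖(∫ x, m (ε⁻¹ • x) • g x) - μY.real E • ∫ x, g x‖ₑ
        ≤ ∫⁻ z in unitCell, ∫⁻ x, ‖g (ε • z + x) - g x‖ₑ := by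
    intro ε hε
    have hmz : ∀ z : E3, Measurable fun x : E3 => m (ε⁻¹ • x + z) := fun z =>
      hmm.comp ((measurable_id.const_smul ε⁻¹).add_const z)
    have i1 : ∀ z : E3, Integrable fun x => m (ε⁻¹ • x + z) • g x := fun z =>
      hg.bdd_smul 1 (hmz z).aestronglyMeasurable (ae_of_all _ fun x => hm1 _)
    have i2 : ∀ z : E3, Integrable fun x => m (ε⁻¹ • x + z) • g (ε • z + x) := fun z =>
      (hg.comp_add_left (ε • z)).bdd_smul 1 (hmz z).aestronglyMeasurable
        (ae_of_all _ fun x => hm1 _)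
    have e1 : ∀ z : E3, ∫ x, m (ε⁻¹ • x) • g x = ∫ x, m (ε⁻¹ • x + z) • g (ε • z + x) := by
      intro z
      rw [← integral_add_left_eq_self (fun x => m (ε⁻¹ • x) • g x) (ε • z)]
      congr 1; ext1 x
      rw [smul_add, smul_smul, inv_mul_cancel₀ hε.ne', one_smul, add_comm z]
    have hint : Integrable (Function.uncurry fun z x : E3 => m (ε⁻¹ • x + z) • g x)
        (μY.prod volume) := by
      have hmp : Measurable fun q : E3 × E3 => m (ε⁻¹ • q.2 + q.1) :=
        hmm.comp ((measurable_snd.const_smul ε⁻¹).add measurable_fst)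
      exact (hg.comp_snd μY).bdd_smul 1 hmp.aestronglyMeasurable
        (ae_of_all _ fun x => hm1 _)
    -- By Fubini the average over `z` can be taken first, and it is the same number for every `x`.
    have e2 : μY.real E • ∫ x, g x = ∫ z in unitCell, ∫ x, m (ε⁻¹ • x + z) • g x := by
      rw [integral_integral_swap hint, ← integral_smul]
      congr 1; ext1 x
      rw [integral_smul_const, ← integral_unitCell_indicator_cellRep hE (ε⁻¹ • x)]
    have e3 : ∫ x, m (ε⁻¹ • x) • g x = ∫ _z in unitCell, ∫ x, m (ε⁻¹ • x) • g x := by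
      rw [integral_const]; simp
    have e4 : (∫ x, m (ε⁻¹ • x) • g x) - μY.real E • ∫ x, g x
        = ∫ z in unitCell, ∫ x, m (ε⁻¹ • x + z) • (g (ε • z + x) - g x) := by
      have hi : Integrable (fun z : E3 => ∫ x, m (ε⁻¹ • x + z) • g x) μY :=
        hint.integral_prod_left
      rw [e3, e2, ← integral_sub (integrable_const _) hi]
      congr 1; ext1 z
      rw [e1 z]
      rw [← integral_sub (i2 z) (i1 z)]
      simp only [smul_sub]
    rw [e4]
    refine (enorm_integral_le_lintegral_enorm _).trans (lintegral_mono fun z => ?_)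
    refine (enorm_integral_le_lintegral_enorm _).trans (lintegral_mono fun x => ?_)
    simp only [enorm_smul]
    refine mul_le_of_le_one_left zero_le ?_
    rw [← ofReal_norm]
    exact ENNReal.ofReal_le_one.2 (hm1 _)
  rw [tendsto_iff_edist_tendsto_0]
  rw [ENNReal.tendsto_nhds_zero]
  intro η hη
  have ht := (ENNReal.tendsto_nhds_zero.1 (tendsto_lintegral_enorm_translate_sub hg)) η hη
  obtain ⟨d, hd, hball⟩ := Metric.eventually_nhds_iff.1 ht
  filter_upwards [Ioo_mem_nhdsGT hd] with ε hε
  rw [edist_eq_enorm_sub]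
  refine (key ε hε.1).trans ?_
  calc ∫⁻ z in unitCell, ∫⁻ x, ‖g (ε • z + x) - g x‖ₑ
      ≤ ∫⁻ _z in unitCell, η := setLIntegral_mono' measurableSet_unitCell fun z hz => by
        refine hball ?_
        rw [dist_zero_right, norm_smul, Real.norm_of_nonneg hε.1.le]
        exact (mul_le_of_le_one_right hε.1.le (norm_le_one_of_mem_unitCell hz)).trans_lt hε.2
    _ = η := by rw [setLIntegral_const, volume_unitCell, mul_one]

/-! ### Bounded operators into `L¹` -/

section Operators

variable {X : Type*} [NormedAddCommGroup X] [NormedSpace ℝ X]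

/-- Passes from pointwise formulas, linear only almost everywhere, to genuine bounded operators, so
that density, compactness and differentiation in time can be used abstractly. -/
theorem exists_continuousLinearMap_L1 {μ : Measure E3} (F : X → E3 → E3)
    (hF : ∀ w, AEStronglyMeasurable (F w) μ)
    (hadd : ∀ w w', F (w + w') =ᵐ[μ] F w + F w') (hsmul : ∀ (c : ℝ) w, F (c • w) =ᵐ[μ] c • F w)
    {C : ℝ≥0∞} (hC : C ≠ ∞) (hb : ∀ w, ∫⁻ x, ‖F w x‖ₑ ∂μ ≤ C * ‖w‖ₑ) :
    ∃ L : X →L[ℝ] Lp E3 1 μ, (∀ w, L w =ᵐ[μ] F w) ∧ ‖L‖ ≤ C.toReal := by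
  have hm : ∀ w, MemLp (F w) 1 μ := fun w => by
    refine ⟨hF w, ?_⟩
    rw [eLpNorm_one_eq_lintegral_enorm]
    exact (hb w).trans_lt (by finiteness)
  let L : X →ₗ[ℝ] Lp E3 1 μ :=
    { toFun := fun w => (hm w).toLp
      map_add' := fun w w' => by
        rw [← MemLp.toLp_add]
        exact (MemLp.toLp_eq_toLp_iff _ _).2 (hadd w w')
      map_smul' := fun c w => by
        rw [RingHom.id_apply, ← MemLp.toLp_const_smul]
        exact (MemLp.toLp_eq_toLp_iff _ _).2 (hsmul c w) }
  have hL : ∀ w, ‖L w‖ ≤ C.toReal * ‖w‖ := fun w => by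
    change ‖(hm w).toLp‖ ≤ _
    rw [Lp.norm_toLp, eLpNorm_one_eq_lintegral_enorm, ← toReal_enorm w, ← ENNReal.toReal_mul]
    exact ENNReal.toReal_mono (by finiteness) (hb w)
  exact ⟨L.mkContinuous C.toReal hL, fun w => (hm w).coeFn_toLp,
    L.mkContinuous_norm_le ENNReal.toReal_nonneg hL⟩

/-- The Bochner integral is additive only on integrable summands; the majorants supply integrability
for almost every `x`. The decomposition is needed only on active bonds, because representatives on
the body are determined only there. -/
theorem IsBondKernel.ae_bondIntegral_add {κ : E3 → E3 → ℝ} {Λ r : ℝ} (hκ : IsBondKernel κ Λ r)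
    (hr : 0 < r) {S : Set E3} (hS : MeasurableSet S) {f g k : E3 → E3 → E3}
    (hf : Measurable (Function.uncurry f)) (hg : Measurable (Function.uncurry g))
    {h₁ h₂ : E3 → ℝ≥0∞} (hh₁ : Measurable h₁) (hh₂ : Measurable h₂)
    (hi₁ : ∫⁻ x, h₁ x ≠ ∞) (hi₂ : ∫⁻ x, h₂ x ≠ ∞)
    (hfh : ∀ x ∈ S, ∀ x', κ x x' ≠ 0 → ‖f x x'‖ₑ ≤ h₁ x + h₁ x')
    (hgh : ∀ x ∈ S, ∀ x', κ x x' ≠ 0 → ‖g x x'‖ₑ ≤ h₂ x + h₂ x')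
    (hk : ∀ᵐ x ∂(volume.restrict S), ∀ᵐ x', κ x x' ≠ 0 → k x x' = f x x' + g x x') :
    bondIntegral κ k =ᵐ[volume.restrict S] bondIntegral κ f + bondIntegral κ g := by
  filter_upwards [hk, hκ.ae_integrable_bondIntegrand hr hS hf hh₁ hi₁ hfh,
    hκ.ae_integrable_bondIntegrand hr hS hg hh₂ hi₂ hgh] with x hx h1 h2
  simp only [bondIntegral, Pi.add_apply]
  rw [← integral_add h1 h2]
  refine integral_congr_ae ?_
  filter_upwards [hx] with x' hx'
  simp only [bondIntegrand]
  by_cases h0 : κ x x' = 0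
  · simp [h0]
  · rw [hx' h0, bondForce_add, smul_add]

/-- The bond integral of a linear family of two-point fields is a bounded operator into `L¹`. -/
theorem IsBondKernel.exists_operator {κ : E3 → E3 → ℝ} {Λ r : ℝ} (hκ : IsBondKernel κ Λ r)
    (hr : 0 < r) {S : Set E3} (hS : MeasurableSet S) (F : X → E3 → E3 → E3)
    (hF : ∀ w, Measurable (Function.uncurry (F w)))
    (hadd : ∀ w w', ∀ᵐ x ∂(volume.restrict S), ∀ᵐ x', κ x x' ≠ 0 →
      F (w + w') x x' = F w x x' + F w' x x')
    (hsmul : ∀ (c : ℝ) w, ∀ᵐ x ∂(volume.restrict S), ∀ᵐ x', κ x x' ≠ 0 →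
      F (c • w) x x' = c • F w x x')
    (h : X → E3 → ℝ≥0∞) (hh : ∀ w, Measurable (h w)) {C : ℝ≥0∞} (hC : C ≠ ∞)
    (hhC : ∀ w, ∫⁻ x, h w x ≤ C * ‖w‖ₑ)
    (hFh : ∀ w, ∀ x ∈ S, ∀ x', κ x x' ≠ 0 → ‖F w x x'‖ₑ ≤ h w x + h w x') :
    ∃ L : X →L[ℝ] Lp E3 1 (volume.restrict S),
      (∀ w, L w =ᵐ[volume.restrict S] bondIntegral κ (F w)) ∧
      ‖L‖ ≤ (2 * (ENNReal.ofReal (Λ * r ^ 2) * rieszMass) * C).toReal := by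
  have hM := rieszMass_ne_top
  have hfin : ∀ w, ∫⁻ x, h w x ≠ ∞ := fun w => ne_top_of_le_ne_top (by finiteness) (hhC w)
  refine exists_continuousLinearMap_L1 (fun w => bondIntegral κ (F w))
    (fun w => (hκ.measurable_bondIntegral (hF w)).aestronglyMeasurable)
    (fun w w' => hκ.ae_bondIntegral_add hr hS (hF w) (hF w') (hh w) (hh w') (hfin w) (hfin w')
      (hFh w) (hFh w') (hadd w w')) (fun c w => ?_) (by finiteness) fun w => ?_
  · filter_upwards [hsmul c w] with x hx
    simp only [bondIntegral, Pi.smul_apply]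
    rw [← integral_smul]
    refine integral_congr_ae ?_
    filter_upwards [hx] with x' hx'
    simp only [bondIntegrand]
    by_cases h0 : κ x x' = 0
    · simp [h0]
    · rw [hx' h0, bondForce_smul, smul_comm]
  · refine (hκ.lintegral_enorm_bondIntegral_le hr hS (hh w) (hFh w)).trans ?_
    rw [mul_assoc _ C]
    gcongr
    exact hhC w

variable {Z : Type*} [NormedAddCommGroup Z] [NormedSpace ℝ Z] {ι : Type*} {l : Filter ι}

/-- Strong convergence to zero of a bounded family of operators is a closed condition. -/
theorem isClosed_setOf_tendsto_zero {L : ι → X →L[ℝ] Z} {C : ℝ} (hC : ∀ᶠ i in l, ‖L i‖ ≤ C) :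
    IsClosed {w | Tendsto (fun i => L i w) l (𝓝 0)} := by
  refine isClosed_of_closure_subset fun w hw => ?_
  rw [mem_ofPred_eq, Metric.tendsto_nhds]
  intro η hη
  have hC' : 0 < |C| + 1 := by positivity
  -- Half of `η` pays for replacing `w` by `w'`; the `+ 1` keeps the denominator positive whatever
  -- the sign of `C`.
  obtain ⟨w', hw', hd⟩ := Metric.mem_closure_iff.1 hw (η / 2 / (|C| + 1)) (by positivity)
  filter_upwards [hC, Metric.tendsto_nhds.1 hw' (η / 2) (by positivity)] with i hi hi'
  rw [dist_zero_right] at hi' ⊢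
  rw [dist_eq_norm, lt_div_iff₀ hC'] at hd
  calc ‖L i w‖ = ‖L i (w - w') + L i w'‖ := by rw [← map_add, sub_add_cancel]
    _ ≤ ‖L i‖ * ‖w - w'‖ + ‖L i w'‖ := (norm_add_le _ _).trans (by gcongr; exact (L i).le_opNorm _)
    _ ≤ (|C| + 1) * ‖w - w'‖ + ‖L i w'‖ := by
        gcongr; exact hi.trans ((le_abs_self C).trans (by linarith))
    _ < η := by linarith

/-- Strong convergence to zero of a bounded family of operators is uniform on compact sets. -/
theorem eventually_forall_norm_le_of_isCompact {L : ι → X →L[ℝ] Z} {C : ℝ}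
    (hC : ∀ᶠ i in l, ‖L i‖ ≤ C) {K : Set X} (hK : IsCompact K)
    (hL : ∀ w ∈ K, Tendsto (fun i => L i w) l (𝓝 0)) {η : ℝ} (hη : 0 < η) :
    ∀ᶠ i in l, ∀ w ∈ K, ‖L i w‖ ≤ η := by
  have hC' : 0 < |C| + 1 := by positivity
  obtain ⟨t, htK, htf, hcov⟩ := hK.finite_cover_balls (e := η / 2 / (|C| + 1)) (by positivity)
  have hev : ∀ᶠ i in l, ∀ w ∈ t, ‖L i w‖ < η / 2 := by
    refine (eventually_all_finite htf).2 fun w hw => ?_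
    simpa using Metric.tendsto_nhds.1 (hL w (htK hw)) (η / 2) (by positivity)
  filter_upwards [hC, hev] with i hi hi' w hw
  obtain ⟨w', hw', hd⟩ := mem_iUnion₂.1 (hcov hw)
  rw [Metric.mem_ball, dist_eq_norm, lt_div_iff₀ hC'] at hd
  calc ‖L i w‖ = ‖L i (w - w') + L i w'‖ := by rw [← map_add, sub_add_cancel]
    _ ≤ ‖L i‖ * ‖w - w'‖ + ‖L i w'‖ := (norm_add_le _ _).trans (by gcongr; exact (L i).le_opNorm _)
    _ ≤ (|C| + 1) * ‖w - w'‖ + ‖L i w'‖ := by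
        gcongr; exact hi.trans ((le_abs_self C).trans (by linarith))
    _ ≤ η := by linarith [hi' w' hw']

end Operators

/-! ### Two-scale fields -/

namespace TwoScaleField

variable {Ω : Set E3} {p : ℝ≥0∞}

theorem eval_of_mem (w : TwoScaleField Ω p) {x : E3} (hx : x ∈ closure Ω) (y : E3) :
    w.eval x y = w (cellRep y) ⟨x, hx⟩ := dif_pos hx

theorem eval_of_notMem (w : TwoScaleField Ω p) {x : E3} (hx : x ∉ closure Ω) (y : E3) :
    w.eval x y = 0 := dif_neg hx

theorem eval_cellRep (w : TwoScaleField Ω p) (x y : E3) : w.eval x (cellRep y) = w.eval x y := by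
  simp only [eval, cellRep_cellRep]

theorem enorm_eval_le (w : TwoScaleField Ω p) (x y : E3) : ‖w.eval x y‖ₑ ≤ ‖w (cellRep y)‖ₑ := by
  by_cases hx : x ∈ closure Ω
  · rw [eval_of_mem w hx, ← ofReal_norm, ← ofReal_norm]
    exact ENNReal.ofReal_le_ofReal ((w (cellRep y)).norm_coe_le_norm _)
  · rw [eval_of_notMem w hx, enorm_zero]
    exact zero_le

/-- Evaluation is jointly continuous in the function and the point. Strong measurability is kept up
to the composition, since the function space need not be second countable. -/
theorem measurable_eval (w : TwoScaleField Ω p) : Measurable fun q : E3 × E3 => w.eval q.1 q.2 := by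
  have h1 : StronglyMeasurable fun q : {q : E3 × E3 // q.1 ∈ closure Ω} =>
      w (cellRep q.1.2) :=
    (Lp.stronglyMeasurable w).comp_measurable
      (measurable_cellRep.comp (measurable_snd.comp measurable_subtype_coe))
  have h2 : StronglyMeasurable fun q : {q : E3 × E3 // q.1 ∈ closure Ω} =>
      (⟨q.1.1, q.2⟩ : closure Ω) :=
    (Measurable.subtype_mk (measurable_fst.comp measurable_subtype_coe)).stronglyMeasurable
  have h3 : Continuous fun v : (closure Ω →ᵇ E3) × closure Ω => v.1 v.2 := by fun_prop
  have h4 := (h3.comp_stronglyMeasurable (h1.prodMk h2)).measurable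
  have hs : MeasurableSet {q : E3 × E3 | q.1 ∈ closure Ω} :=
    measurable_fst isClosed_closure.measurableSet
  refine measurable_of_restrict_of_restrict_compl hs ?_ ?_
  · have h5 : {q : E3 × E3 | q.1 ∈ closure Ω}.domRestrict (fun q : E3 × E3 => w.eval q.1 q.2)
        = fun q => w (cellRep q.1.2) ⟨q.1.1, q.2⟩ := by
      ext1 q
      exact eval_of_mem w q.2 q.1.2
    rw [h5]
    exact h4
  · have h5 : ({q : E3 × E3 | q.1 ∈ closure Ω}ᶜ).domRestrict (fun q : E3 × E3 => w.eval q.1 q.2)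
        = fun _ => 0 := by
      ext1 q
      exact eval_of_notMem w q.2 q.1.2
    rw [h5]
    exact measurable_const

theorem measurable_enorm (w : TwoScaleField Ω p) : Measurable fun y => ‖w y‖ₑ :=
  (Lp.stronglyMeasurable w).enorm

/-- The cell has measure one, so exponents can be lowered without a constant. -/
theorem lintegral_enorm_le [Fact (1 ≤ p)] (w : TwoScaleField Ω p) :
    ∫⁻ y in unitCell, ‖w y‖ₑ ≤ ‖w‖ₑ := by
  rw [← eLpNorm_one_eq_lintegral_enorm, Lp.enorm_def]
  exact eLpNorm_le_eLpNorm_of_exponent_le Fact.out (Lp.aestronglyMeasurable w)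

theorem measurable_rescale (w : TwoScaleField Ω p) (ε : ℝ) : Measurable (w.rescale ε) :=
  w.measurable_eval.comp (measurable_id.prodMk (measurable_id.const_smul ε⁻¹))

theorem measurable_macro_part (w : TwoScaleField Ω p) : Measurable w.macro_part :=
  (w.measurable_eval.stronglyMeasurable.integral_prod_right').measurable

theorem lintegral_enorm_eval_le [Fact (1 ≤ p)] (w : TwoScaleField Ω p) (x : E3) :
    ∫⁻ y in unitCell, ‖w.eval x y‖ₑ ≤ ‖w‖ₑ := by
  refine le_trans (setLIntegral_mono' measurableSet_unitCell fun y hy => ?_) w.lintegral_enorm_le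
  simpa [cellRep_of_mem hy] using w.enorm_eval_le x y

theorem integrable_eval [Fact (1 ≤ p)] (w : TwoScaleField Ω p) (x : E3) :
    Integrable (w.eval x) (volume.restrict unitCell) :=
  ⟨(w.measurable_eval.comp measurable_prodMk_left).aestronglyMeasurable,
    (w.lintegral_enorm_eval_le x).trans_lt (by finiteness)⟩

theorem enorm_macro_part_le [Fact (1 ≤ p)] (w : TwoScaleField Ω p) (x : E3) :
    ‖w.macro_part x‖ₑ ≤ ‖w‖ₑ :=
  (enorm_integral_le_lintegral_enorm _).trans (w.lintegral_enorm_eval_le x)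

theorem ae_eval_add (w w' : TwoScaleField Ω p) :
    ∀ᵐ y ∂(volume.restrict unitCell), ∀ x, (w + w').eval x y = w.eval x y + w'.eval x y := by
  filter_upwards [Lp.coeFn_add w w', ae_restrict_mem measurableSet_unitCell] with y hy hY x
  by_cases hx : x ∈ closure Ω
  · simp only [eval_of_mem _ hx, cellRep_of_mem hY, hy]
    rfl
  · simp only [eval_of_notMem _ hx, add_zero]

theorem ae_eval_smul (c : ℝ) (w : TwoScaleField Ω p) :
    ∀ᵐ y ∂(volume.restrict unitCell), ∀ x, (c • w).eval x y = c • w.eval x y := by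
  filter_upwards [Lp.coeFn_smul c w, ae_restrict_mem measurableSet_unitCell] with y hy hY x
  by_cases hx : x ∈ closure Ω
  · simp only [eval_of_mem _ hx, cellRep_of_mem hY, hy]
    rfl
  · simp only [eval_of_notMem _ hx, smul_zero]

theorem ae_eval_add_rescale (w w' : TwoScaleField Ω p) {ε : ℝ} (hε : 0 < ε) :
    ∀ᵐ x', ∀ x, (w + w').eval x (ε⁻¹ • x') = w.eval x (ε⁻¹ • x') + w'.eval x (ε⁻¹ • x') := by
  filter_upwards [ae_cellRep_of_ae (ae_eval_add w w') hε] with x' hx'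
  simpa only [eval_cellRep] using hx'

theorem ae_eval_smul_rescale (c : ℝ) (w : TwoScaleField Ω p) {ε : ℝ} (hε : 0 < ε) :
    ∀ᵐ x', ∀ x, (c • w).eval x (ε⁻¹ • x') = c • w.eval x (ε⁻¹ • x') := by
  filter_upwards [ae_cellRep_of_ae (ae_eval_smul c w) hε] with x' hx'
  simpa only [eval_cellRep] using hx'

theorem macro_part_add [Fact (1 ≤ p)] (w w' : TwoScaleField Ω p) (x : E3) :
    (w + w').macro_part x = w.macro_part x + w'.macro_part x := by
  rw [macro_part, macro_part, macro_part,
    ← integral_add (w.integrable_eval x) (w'.integrable_eval x)]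
  refine integral_congr_ae ?_
  filter_upwards [ae_eval_add w w'] with y hy using hy x

theorem macro_part_smul (c : ℝ) (w : TwoScaleField Ω p) (x : E3) :
    (c • w).macro_part x = c • w.macro_part x := by
  rw [macro_part, macro_part, ← integral_smul]
  refine integral_congr_ae ?_
  filter_upwards [ae_eval_smul c w] with y hy using hy x

end TwoScaleField

/-! ### The medium and its bond kernels -/

namespace PeridynamicMedium

variable (M : PeridynamicMedium)

theorem χf_eq_zero_or_one (y : E3) : M.χf y = 0 ∨ M.χf y = 1 := by
  unfold χf; split_ifs <;> simp

theorem χf_cellRep (y : E3) : M.χf (cellRep y) = M.χf y := by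
  unfold χf; rw [cellRep_cellRep]

theorem ρ_cellRep (y : E3) : M.ρ (cellRep y) = M.ρ y := by
  simp only [ρ, χm, χf_cellRep]

theorem α_cellRep_add_latticeVec (y y' : E3) (k : Fin 3 → ℤ) :
    M.α (y + latticeVec k) (y' + latticeVec k) = M.α y y' := by
  have h : ∀ z, M.χf (z + latticeVec k) = M.χf z := fun z => by
    unfold χf; rw [cellRep_add_latticeVec]
  simp only [α, χm, h]

theorem measurable_χf : Measurable M.χf :=
  Measurable.ite (measurable_cellRep M.measurableSet_inclusion) measurable_const measurable_const

theorem measurable_α : Measurable (Function.uncurry M.α) := by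
  have h1 : Measurable fun q : E3 × E3 => M.χf q.1 := M.measurable_χf.comp measurable_fst
  have h2 : Measurable fun q : E3 × E3 => M.χf q.2 := M.measurable_χf.comp measurable_snd
  have : Function.uncurry M.α = fun q : E3 × E3 => M.Cf * (M.χf q.1 * M.χf q.2)
      + M.Cm * ((1 - M.χf q.1) * (1 - M.χf q.2))
      + M.Ci * (M.χf q.1 * (1 - M.χf q.2) + (1 - M.χf q.1) * M.χf q.2) := rfl
  rw [this]
  fun_prop

/-- An upper bound of the bond strength. -/
def αmax : ℝ := M.Cf + M.Cm + M.Ci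

theorem abs_α_le (y y' : E3) : |M.α y y'| ≤ M.αmax := by
  have h1 := M.Cf_pos
  have h2 := M.Cm_pos
  have h3 := M.Ci_pos
  unfold α αmax χm
  rcases M.χf_eq_zero_or_one y with h | h <;> rcases M.χf_eq_zero_or_one y' with h' | h' <;>
    rw [h, h', abs_le] <;> constructor <;> linarith

/-- The smaller one of the two densities. -/
def ρmin : ℝ := min M.ρf M.ρm

theorem ρmin_pos : 0 < M.ρmin := lt_min M.ρf_pos M.ρm_pos

theorem ρmin_le (y : E3) : M.ρmin ≤ M.ρ y := by
  unfold ρ χm ρmin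
  rcases M.χf_eq_zero_or_one y with h | h <;> simp [h]

end PeridynamicMedium

/-! ### Cut-off kernels and the bond operators on the body. -/

/-- The kernel `a`, cut off at the distance `r` and to the set `D`. -/
def cutoff (D : Set E3) (r : ℝ) (a : E3 → E3 → ℝ) (x x' : E3) : ℝ :=
  (Metric.ball x r ∩ D).indicator (a x) x'

theorem cutoff_ne_zero {D : Set E3} {r : ℝ} {a : E3 → E3 → ℝ} {x x' : E3}
    (h : cutoff D r a x x' ≠ 0) : ‖x' - x‖ < r ∧ x' ∈ D := by
  have := mem_of_indicator_ne_zero h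
  rwa [mem_inter_iff, mem_ball_iff_norm] at this

theorem isBondKernel_cutoff {D : Set E3} (hD : MeasurableSet D) (r : ℝ) {a : E3 → E3 → ℝ}
    (ha : Measurable (Function.uncurry a)) {Λ : ℝ} (haΛ : ∀ x x', |a x x'| ≤ Λ) :
    IsBondKernel (cutoff D r a) Λ r where
  measurable := by
    have hs : MeasurableSet {q : E3 × E3 | ‖q.2 - q.1‖ < r ∧ q.2 ∈ D} :=
      (measurableSet_lt (measurable_snd.sub measurable_fst).norm measurable_const).inter
        (measurable_snd hD)
    have : Function.uncurry (cutoff D r a)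
        = {q : E3 × E3 | ‖q.2 - q.1‖ < r ∧ q.2 ∈ D}.indicator (Function.uncurry a) := by
      ext ⟨x, x'⟩
      have hiff : x' ∈ Metric.ball x r ∩ D ↔
          (x, x') ∈ {q : E3 × E3 | ‖q.2 - q.1‖ < r ∧ q.2 ∈ D} := by
        rw [mem_inter_iff, mem_ball_iff_norm]; rfl
      simp only [Function.uncurry_apply_pair, cutoff]
      by_cases hx : x' ∈ Metric.ball x r ∩ D
      · rw [indicator_of_mem hx, indicator_of_mem (hiff.1 hx), Function.uncurry_apply_pair]
      · rw [indicator_of_notMem hx, indicator_of_notMem (fun h => hx (hiff.2 h))]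
    rw [this]
    exact ha.indicator hs
  abs_le x x' := by
    unfold cutoff indicator
    split_ifs
    · exact haΛ x x'
    · simpa using (abs_nonneg _).trans (haΛ x x')
  eq_zero x x' h := by
    by_contra hc
    exact absurd (cutoff_ne_zero hc).1 (not_lt.2 h)

theorem bondIntegral_cutoff {D : Set E3} (hD : MeasurableSet D) (r : ℝ) (a : E3 → E3 → ℝ)
    (f : E3 → E3 → E3) (x : E3) :
    bondIntegral (cutoff D r a) f x
      = ∫ x' in Metric.ball x r ∩ D, a x x' • bondForce (x' - x) (f x x') := by
  rw [← integral_indicator (Metric.isOpen_ball.measurableSet.inter hD)]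
  refine integral_congr_ae (ae_of_all _ fun x' => ?_)
  simp only [bondIntegrand, cutoff, indicator]
  split_ifs <;> simp

/-- The bond operator on integrable fields on the body. -/
theorem exists_bond_operator {Ω : Set E3} (hΩ : MeasurableSet Ω) {r : ℝ} (hr : 0 < r)
    {a : E3 → E3 → ℝ} {Λ : ℝ} (hκ : IsBondKernel (cutoff Ω r a) Λ r) :
    ∃ K : Lp E3 1 (volume.restrict Ω) →L[ℝ] Lp E3 1 (volume.restrict Ω),
      (∀ f, K f =ᵐ[volume.restrict Ω] bondIntegral (cutoff Ω r a) fun x x' => f x' - f x) ∧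
      ‖K‖ ≤ (2 * (ENNReal.ofReal (Λ * r ^ 2) * rieszMass) * 1).toReal := by
  refine hκ.exists_operator hr hΩ (fun (f : Lp E3 1 (volume.restrict Ω)) x x' => f x' - f x)
    (fun f => ?_) (fun f g => ?_) (fun c f => ?_) (fun f => Ω.indicator fun x => ‖f x‖ₑ)
    (fun f => (Lp.stronglyMeasurable f).enorm.indicator hΩ) ENNReal.one_ne_top (fun f => ?_)
    fun f x hx x' hx' => ?_
  · have := (Lp.stronglyMeasurable f).measurable
    exact (this.comp measurable_snd).sub (this.comp measurable_fst)
  · have h := Lp.coeFn_add f g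
    have h' := (ae_restrict_iff' hΩ).1 h
    filter_upwards [h] with x hx
    filter_upwards [h'] with x' hx' hk
    rw [hx, hx' (cutoff_ne_zero hk).2]
    simp only [Pi.add_apply]
    abel
  · have h := Lp.coeFn_smul c f
    have h' := (ae_restrict_iff' hΩ).1 h
    filter_upwards [h] with x hx
    filter_upwards [h'] with x' hx' hk
    rw [hx, hx' (cutoff_ne_zero hk).2]
    simp only [Pi.smul_apply, smul_sub]
  · rw [lintegral_indicator hΩ, one_mul, Lp.enorm_def, eLpNorm_one_eq_lintegral_enorm]
  · rw [indicator_of_mem hx, indicator_of_mem (cutoff_ne_zero hx').2, add_comm]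
    exact enorm_sub_le

/-! ### Majorants and operators on two-scale fields. -/

namespace TwoScaleField

variable {Ω : Set E3} {p : ℝ≥0∞}

/-- A common majorant of the fields entering the residual operators. -/
def majorant (R ε : ℝ) (w : TwoScaleField Ω p) (x : E3) : ℝ≥0∞ :=
  (Metric.ball (0 : E3) R).indicator (fun x => 2 * ‖w (cellRep (ε⁻¹ • x))‖ₑ + ‖w‖ₑ) x

theorem measurable_enorm_cell (w : TwoScaleField Ω p) (ε : ℝ) :
    Measurable fun x : E3 => ‖w (cellRep (ε⁻¹ • x))‖ₑ :=
  w.measurable_enorm.comp (measurable_cellRep.comp (measurable_id.const_smul ε⁻¹))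

theorem measurable_majorant (R ε : ℝ) (w : TwoScaleField Ω p) : Measurable (w.majorant R ε) :=
  (((w.measurable_enorm_cell ε).const_mul 2).add_const _).indicator
    Metric.isOpen_ball.measurableSet

/-- The factor three is two for the rescaled term plus one for the constant term. -/
theorem lintegral_majorant_le [Fact (1 ≤ p)] (R : ℝ) {ε : ℝ} (hε : 0 < ε)
    (w : TwoScaleField Ω p) :
    ∫⁻ x, w.majorant R ε x ≤ 3 * volume (Metric.ball (0 : E3) (R + ε)) * ‖w‖ₑ := by
  unfold majorant
  rw [lintegral_indicator Metric.isOpen_ball.measurableSet,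
    lintegral_add_right _ measurable_const, setLIntegral_const,
    lintegral_const_mul _ (w.measurable_enorm_cell ε)]
  calc 2 * (∫⁻ x in Metric.ball (0 : E3) R, ‖w (cellRep (ε⁻¹ • x))‖ₑ)
        + ‖w‖ₑ * volume (Metric.ball (0 : E3) R)
      ≤ 2 * (volume (Metric.ball (0 : E3) (R + ε)) * ‖w‖ₑ)
        + ‖w‖ₑ * volume (Metric.ball (0 : E3) (R + ε)) := by
        gcongr
        · refine (lintegral_ball_rescale_le w.measurable_enorm hε).trans ?_
          gcongr
          exact w.lintegral_enorm_le
        · linarith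
    _ = _ := by ring

theorem le_majorant {R ε : ℝ} (w : TwoScaleField Ω p) {x : E3} (hx : ‖x‖ < R) :
    2 * ‖w (cellRep (ε⁻¹ • x))‖ₑ + ‖w‖ₑ ≤ w.majorant R ε x := by
  rw [majorant, indicator_of_mem (by simpa using hx)]

/-- The two-scale fields, rescaled and restricted to the body, are integrable. -/
theorem exists_rescale_operator [Fact (1 ≤ p)] {R : ℝ} (hR : Ω ⊆ Metric.ball 0 R)
    {ε : ℝ} (hε : 0 < ε) :
    ∃ S : TwoScaleField Ω p →L[ℝ] Lp E3 1 (volume.restrict Ω),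
      (∀ w, S w =ᵐ[volume.restrict Ω] w.rescale ε) ∧
      ‖S‖ ≤ (volume (Metric.ball (0 : E3) (R + ε))).toReal := by
  refine exists_continuousLinearMap_L1 (fun w : TwoScaleField Ω p => w.rescale ε)
    (fun w => (w.measurable_rescale ε).aestronglyMeasurable) (fun w w' => ?_) (fun c w => ?_)
    measure_ball_lt_top.ne fun w => ?_
  · filter_upwards [ae_restrict_of_ae (ae_eval_add_rescale w w' hε)] with x hx using hx x
  · filter_upwards [ae_restrict_of_ae (ae_eval_smul_rescale c w hε)] with x hx using hx x
  · calc ∫⁻ x in Ω, ‖w.rescale ε x‖ₑ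
        ≤ ∫⁻ x in Metric.ball (0 : E3) R, ‖w (cellRep (ε⁻¹ • x))‖ₑ :=
          (lintegral_mono fun x => w.enorm_eval_le x _).trans (lintegral_mono_set hR)
      _ ≤ _ := by
          refine (lintegral_ball_rescale_le w.measurable_enorm hε).trans ?_
          gcongr
          exact w.lintegral_enorm_le

/-- The macroscopic parts are integrable. -/
theorem exists_macro_operator [Fact (1 ≤ p)] {R : ℝ} (hR : Ω ⊆ Metric.ball 0 R) :
    ∃ H : TwoScaleField Ω p →L[ℝ] Lp E3 1 (volume.restrict Ω),
      ∀ w, H w =ᵐ[volume.restrict Ω] w.macro_part := by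
  obtain ⟨H, hH, -⟩ := exists_continuousLinearMap_L1 (X := TwoScaleField Ω p)
    (μ := volume.restrict Ω) (C := volume (Metric.ball (0 : E3) R)) (fun w => w.macro_part)
    (fun w => w.measurable_macro_part.aestronglyMeasurable)
    (fun w w' => ae_of_all _ (macro_part_add w w')) (fun c w => ae_of_all _ (macro_part_smul c w))
    measure_ball_lt_top.ne fun w => by
      refine (lintegral_mono fun x => w.enorm_macro_part_le x).trans ?_
      rw [setLIntegral_const, mul_comm]
      gcongr
  exact ⟨H, hH⟩

/-- The residual operators. A bond operator applied to a two-point field that is controlled by a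
two-scale field. -/
theorem exists_residual_operator [Fact (1 ≤ p)] {R : ℝ} (hR : Ω ⊆ Metric.ball 0 R)
    (hΩ : MeasurableSet Ω) {r r' : ℝ} (hr : 0 < r) (hrr' : r ≤ r') {D : Set E3}
    {a : E3 → E3 → ℝ} {Λ : ℝ} (hκ : IsBondKernel (cutoff D r a) Λ r) {ε : ℝ} (hε : 0 < ε)
    (F : TwoScaleField Ω p → E3 → E3 → E3)
    (hF : ∀ w, Measurable (Function.uncurry (F w)))
    (hadd : ∀ w w', ∀ᵐ x, ∀ᵐ x', F (w + w') x x' = F w x x' + F w' x x')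
    (hsmul : ∀ (c : ℝ) w, ∀ᵐ x, ∀ᵐ x', F (c • w) x x' = c • F w x x')
    (hFh : ∀ w x x', ‖F w x x'‖ₑ ≤ (2 * ‖w (cellRep (ε⁻¹ • x))‖ₑ + ‖w‖ₑ)
      + (2 * ‖w (cellRep (ε⁻¹ • x'))‖ₑ + ‖w‖ₑ)) :
    ∃ L : TwoScaleField Ω p →L[ℝ] Lp E3 1 (volume.restrict Ω),
      (∀ w, L w =ᵐ[volume.restrict Ω] bondIntegral (cutoff D r a) (F w)) ∧
      ‖L‖ ≤ (2 * (ENNReal.ofReal (Λ * r ^ 2) * rieszMass)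
        * (3 * volume (Metric.ball (0 : E3) (R + r' + ε)))).toReal := by
  refine hκ.exists_operator hr hΩ F hF
    (fun w w' => ae_restrict_of_ae ((hadd w w').mono fun x hx => hx.mono fun x' hx' _ => hx'))
    (fun c w => ae_restrict_of_ae ((hsmul c w).mono fun x hx => hx.mono fun x' hx' _ => hx'))
    (fun w => w.majorant (R + r') ε) (fun w => w.measurable_majorant _ _)
    (ENNReal.mul_ne_top (by simp) measure_ball_lt_top.ne)
    (fun w => w.lintegral_majorant_le _ hε) fun w x hx x' hx' => ?_
  -- An active bond starting in the body ends in the ball of radius `R + r'`. Using `r'` instead of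
  -- `r` permits a radius independent of `ε`.
  have h1 : ‖x‖ < R := by simpa using hR hx
  have h2 := (cutoff_ne_zero hx').1
  have h3 : ‖x'‖ ≤ ‖x' - x‖ + ‖x‖ := by simpa using norm_add_le (x' - x) x
  exact (hFh w x x').trans
    (add_le_add (w.le_majorant (by linarith)) (w.le_majorant (by linarith)))

end TwoScaleField

namespace PeridynamicMedium

variable (M : PeridynamicMedium)

/-- The kernel of the long range force. -/
def longKernel : E3 → E3 → ℝ := cutoff M.Ω M.γ fun _ _ => M.lam

/-- The kernel of the short range force at scale `ε`, cut off to a set `D`. -/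
def shortKernel (ε : ℝ) (D : Set E3) : E3 → E3 → ℝ :=
  cutoff D (ε * M.δ) fun x x' => (ε ^ 2)⁻¹ * M.α (ε⁻¹ • x) (ε⁻¹ • x')

theorem measurableSet_Ω : MeasurableSet M.Ω := M.isOpen_Ω.measurableSet

theorem isBondKernel_longKernel : IsBondKernel M.longKernel M.lam M.γ :=
  isBondKernel_cutoff M.measurableSet_Ω _ measurable_const fun _ _ => (abs_of_pos M.lam_pos).le

theorem isBondKernel_shortKernel (ε : ℝ) {D : Set E3} (hD : MeasurableSet D) :
    IsBondKernel (M.shortKernel ε D) ((ε ^ 2)⁻¹ * M.αmax) (ε * M.δ) := by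
  refine isBondKernel_cutoff hD _ ?_ fun x x' => ?_
  · have h : Measurable fun q : E3 × E3 => (ε⁻¹ • q.1, ε⁻¹ • q.2) :=
      (measurable_fst.const_smul ε⁻¹).prodMk (measurable_snd.const_smul ε⁻¹)
    exact (M.measurable_α.comp h).const_mul _
  · rw [abs_mul, abs_of_nonneg (by positivity : (0 : ℝ) ≤ (ε ^ 2)⁻¹)]
    gcongr
    exact M.abs_α_le _ _

/-- The cancellation that makes all short range estimates uniform in `ε`. -/
theorem shortKernel_strength {ε : ℝ} (hε : 0 < ε) :
    (ε ^ 2)⁻¹ * M.αmax * (ε * M.δ) ^ 2 = M.αmax * M.δ ^ 2 := by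
  field_simp

end PeridynamicMedium

theorem IsBondKernel.enorm_bondIntegral_le_const {κ : E3 → E3 → ℝ} {Λ r : ℝ}
    {f : E3 → E3 → E3} (hκ : IsBondKernel κ Λ r) (hr : 0 < r) (x : E3)
    {c : ℝ≥0∞} (hfc : ∀ᵐ x', κ x x' ≠ 0 → ‖f x x'‖ₑ ≤ c) :
    ‖bondIntegral κ f x‖ₑ ≤ ENNReal.ofReal (Λ * r ^ 2) * rieszMass * c :=
  (enorm_integral_le_lintegral_enorm _).trans (hκ.lintegral_enorm_bondIntegrand_le_const hr x hfc)

/-- Dominated convergence with a constant bound, stated through representatives `J ε` because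
pointwise limits make sense only for them. -/
theorem tendsto_L1_zero_of_bounded {μ : Measure E3} [IsFiniteMeasure μ] {l : Filter ℝ}
    [l.IsCountablyGenerated] {L : ℝ → Lp E3 1 μ} {J : ℝ → E3 → E3} {C : ℝ≥0∞} (hC : C ≠ ∞)
    (hL : ∀ᶠ ε in l, L ε =ᵐ[μ] J ε) (hJ : ∀ᶠ ε in l, ∀ᵐ x ∂μ, ‖J ε x‖ₑ ≤ C)
    (hlim : ∀ᵐ x ∂μ, Tendsto (fun ε => J ε x) l (𝓝 0)) : Tendsto L l (𝓝 0) := by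
  rw [tendsto_zero_iff_norm_tendsto_zero]
  have h : Tendsto (fun ε => ∫ x, ‖J ε x‖ ∂μ) l (𝓝 (∫ _x, (0 : ℝ) ∂μ)) := by
    refine tendsto_integral_filter_of_dominated_convergence (fun _ => C.toReal) ?_ ?_
      (integrable_const _) ?_
    · filter_upwards [hL] with ε hε
      exact ((Lp.aestronglyMeasurable (L ε)).congr hε).norm
    · filter_upwards [hJ] with ε hε
      filter_upwards [hε] with x hx
      rw [norm_norm, ← toReal_enorm]
      exact ENNReal.toReal_mono hC hx
    · filter_upwards [hlim] with x hx
      simpa using hx.norm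
  rw [integral_zero] at h
  refine h.congr' ?_
  filter_upwards [hL] with ε hε
  rw [L1.norm_eq_integral_norm]
  exact integral_congr_ae (hε.symm.mono fun x hx => by simp only [hx])

/-! ### The residual fields, and the simple two-scale fields on which they are tested. -/

namespace TwoScaleField

variable {Ω : Set E3} {p : ℝ≥0∞}

/-- The oscillation of the rescaled field about its macroscopic part. -/
def fluctuation (ε : ℝ) (w : TwoScaleField Ω p) (_x x' : E3) : E3 :=
  w.rescale ε x' - w.macro_part x'

/-- The difference in the slow variable. -/
def slowDiff (ε : ℝ) (w : TwoScaleField Ω p) (x x' : E3) : E3 :=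
  w.eval x' (ε⁻¹ • x') - w.eval x (ε⁻¹ • x')

/-- The difference in the fast variable. -/
def fastDiff (ε : ℝ) (w : TwoScaleField Ω p) (x x' : E3) : E3 :=
  w.eval x (ε⁻¹ • x') - w.eval x (ε⁻¹ • x)

theorem measurable_fluctuation (ε : ℝ) (w : TwoScaleField Ω p) :
    Measurable (Function.uncurry (w.fluctuation ε)) :=
  ((w.measurable_rescale ε).sub w.measurable_macro_part).comp measurable_snd

theorem measurable_eval_rescale_prod (ε : ℝ) (w : TwoScaleField Ω p) :
    Measurable fun q : E3 × E3 => w.eval q.1 (ε⁻¹ • q.2) :=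
  w.measurable_eval.comp (measurable_fst.prodMk (measurable_snd.const_smul ε⁻¹))

theorem measurable_slowDiff (ε : ℝ) (w : TwoScaleField Ω p) :
    Measurable (Function.uncurry (w.slowDiff ε)) :=
  ((w.measurable_rescale ε).comp measurable_snd).sub (w.measurable_eval_rescale_prod ε)

theorem measurable_fastDiff (ε : ℝ) (w : TwoScaleField Ω p) :
    Measurable (Function.uncurry (w.fastDiff ε)) :=
  (w.measurable_eval_rescale_prod ε).sub ((w.measurable_rescale ε).comp measurable_fst)

section Bounds

variable (ε : ℝ) (w : TwoScaleField Ω p) (x x' : E3)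

theorem enorm_slowDiff_le : ‖w.slowDiff ε x x'‖ₑ ≤ (2 * ‖w (cellRep (ε⁻¹ • x))‖ₑ + ‖w‖ₑ)
      + (2 * ‖w (cellRep (ε⁻¹ • x'))‖ₑ + ‖w‖ₑ) := by
  calc _ ≤ ‖w (cellRep (ε⁻¹ • x'))‖ₑ + ‖w (cellRep (ε⁻¹ • x'))‖ₑ :=
        enorm_sub_le.trans (add_le_add (w.enorm_eval_le _ _) (w.enorm_eval_le _ _))
    _ = 2 * ‖w (cellRep (ε⁻¹ • x'))‖ₑ := (two_mul _).symm
    _ ≤ _ := le_add_left le_self_add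

theorem enorm_fastDiff_le : ‖w.fastDiff ε x x'‖ₑ ≤ (2 * ‖w (cellRep (ε⁻¹ • x))‖ₑ + ‖w‖ₑ)
      + (2 * ‖w (cellRep (ε⁻¹ • x'))‖ₑ + ‖w‖ₑ) := by
  calc _ ≤ ‖w (cellRep (ε⁻¹ • x'))‖ₑ + ‖w (cellRep (ε⁻¹ • x))‖ₑ :=
        enorm_sub_le.trans (add_le_add (w.enorm_eval_le _ _) (w.enorm_eval_le _ _))
    _ = 1 * ‖w (cellRep (ε⁻¹ • x))‖ₑ + 1 * ‖w (cellRep (ε⁻¹ • x'))‖ₑ := by ring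
    _ ≤ 2 * ‖w (cellRep (ε⁻¹ • x))‖ₑ + 2 * ‖w (cellRep (ε⁻¹ • x'))‖ₑ := by
        gcongr <;> exact one_le_two
    _ ≤ _ := add_le_add le_self_add le_self_add

theorem enorm_fluctuation_le [Fact (1 ≤ p)] :
    ‖w.fluctuation ε x x'‖ₑ ≤ (2 * ‖w (cellRep (ε⁻¹ • x))‖ₑ + ‖w‖ₑ)
      + (2 * ‖w (cellRep (ε⁻¹ • x'))‖ₑ + ‖w‖ₑ) := by
  calc _ ≤ 1 * ‖w (cellRep (ε⁻¹ • x'))‖ₑ + ‖w‖ₑ := by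
        rw [one_mul]
        exact enorm_sub_le.trans (add_le_add (w.enorm_eval_le _ _) (w.enorm_macro_part_le _))
    _ ≤ 2 * ‖w (cellRep (ε⁻¹ • x'))‖ₑ + ‖w‖ₑ := by gcongr; exact one_le_two
    _ ≤ _ := le_add_left le_rfl

end Bounds

/-- The extension by zero of a field on the closure of the body. -/
def extendZero (φ : closure Ω →ᵇ E3) : E3 → E3 := Function.extend Subtype.val φ 0

theorem extendZero_of_mem (φ : closure Ω →ᵇ E3) {x : E3} (hx : x ∈ closure Ω) :
    extendZero φ x = φ ⟨x, hx⟩ := Subtype.val_injective.extend_apply φ 0 ⟨x, hx⟩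

theorem extendZero_of_notMem (φ : closure Ω →ᵇ E3) {x : E3} (hx : x ∉ closure Ω) :
    extendZero φ x = 0 := by
  refine Function.extend_apply' _ _ _ ?_
  rintro ⟨y, rfl⟩
  exact hx y.2

theorem measurable_extendZero (φ : closure Ω →ᵇ E3) : Measurable (extendZero φ) :=
  (MeasurableEmbedding.subtype_coe isClosed_closure.measurableSet).measurable_extend
    φ.continuous.measurable measurable_const

theorem enorm_extendZero_le (φ : closure Ω →ᵇ E3) (x : E3) : ‖extendZero φ x‖ₑ ≤ ‖φ‖ₑ := by
  by_cases hx : x ∈ closure Ω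
  · rw [extendZero_of_mem φ hx, ← ofReal_norm, ← ofReal_norm]
    exact ENNReal.ofReal_le_ofReal (φ.norm_coe_le_norm _)
  · rw [extendZero_of_notMem φ hx, enorm_zero]; exact zero_le

/-- The extension by zero may jump at the boundary, but an interior point has a neighbourhood inside
the closure. -/
theorem continuousAt_extendZero (hΩ : IsOpen Ω) (φ : closure Ω →ᵇ E3) {x : E3} (hx : x ∈ Ω) :
    ContinuousAt (extendZero φ) x := by
  have h : ContinuousOn (extendZero φ) (closure Ω) := by
    rw [continuousOn_iff_continuous_domRestrict]
    have h1 : (closure Ω).domRestrict (extendZero φ) = φ :=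
      funext fun y => extendZero_of_mem φ y.2
    rw [h1]
    exact φ.continuous
  exact h.continuousAt (mem_of_superset (hΩ.mem_nhds hx) subset_closure)

section Simple

variable {s : Set E3} (hs : MeasurableSet s)
  (hμs : volume.restrict unitCell s ≠ ∞) (φ : closure Ω →ᵇ E3)

variable (p) in
/-- The two-scale field `1_s(y) φ(x)`. -/
def simpleField : TwoScaleField Ω p := indicatorConstLp p hs hμs φ

theorem ae_eval_indicatorConst :
    ∀ᵐ y ∂(volume.restrict unitCell), ∀ x,
      (simpleField p hs hμs φ).eval x y
        = s.indicator (fun _ => (1 : ℝ)) y • extendZero φ x := by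
  have h0 : simpleField p hs hμs φ =ᵐ[volume.restrict unitCell] s.indicator fun _ => φ :=
    indicatorConstLp_coeFn
  filter_upwards [h0, ae_restrict_mem measurableSet_unitCell] with y hy hY x
  by_cases hx : x ∈ closure Ω
  · rw [eval_of_mem _ hx, cellRep_of_mem hY, hy, extendZero_of_mem φ hx]
    by_cases h : y ∈ s
    · simp [h]
    · simp [h]
  · rw [eval_of_notMem _ hx, extendZero_of_notMem φ hx, smul_zero]

theorem ae_eval_indicatorConst_rescale {ε : ℝ} (hε : 0 < ε) :
    ∀ᵐ x', ∀ x, (simpleField p hs hμs φ).eval x (ε⁻¹ • x')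
        = s.indicator (fun _ => (1 : ℝ)) (cellRep (ε⁻¹ • x')) • extendZero φ x := by
  filter_upwards [ae_cellRep_of_ae (ae_eval_indicatorConst (p := p) hs hμs φ) hε] with x' hx'
  simpa only [eval_cellRep] using hx'

theorem macro_part_indicatorConst (x : E3) :
    (simpleField p hs hμs φ).macro_part x
      = (volume.restrict unitCell).real s • extendZero φ x := by
  rw [macro_part, integral_congr_ae ((ae_eval_indicatorConst hs hμs φ).mono fun y hy => hy x),
    integral_smul_const]
  congr 1
  exact integral_indicator_one hs

theorem enorm_indicator_smul_le (z x : E3) :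
    ‖s.indicator (fun _ => (1 : ℝ)) z • extendZero φ x‖ₑ ≤ ‖φ‖ₑ := by
  rw [enorm_smul]
  refine (mul_le_of_le_one_left zero_le ?_).trans (enorm_extendZero_le φ x)
  by_cases h : z ∈ s <;> simp [h]

end Simple

end TwoScaleField

/-! ### Convergence of the residuals -/

/-- For finite `p` the indicator fields generate a dense subspace, and for uniformly bounded
operators the fields with vanishing limit form a closed one. -/
theorem TwoScaleField.tendsto_zero_of_simple {Ω : Set E3} {p : ℝ≥0∞} [Fact (1 ≤ p)]
    (hp : p ≠ ∞) {Z : Type*} [NormedAddCommGroup Z] [NormedSpace ℝ Z] {l : Filter ℝ}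
    {L : ℝ → TwoScaleField Ω p →L[ℝ] Z} {C : ℝ} (hC : ∀ᶠ ε in l, ‖L ε‖ ≤ C)
    (h : ∀ (s : Set E3) (hs : MeasurableSet s) (hμs : volume.restrict unitCell s ≠ ∞)
      (φ : closure Ω →ᵇ E3), Tendsto (fun ε => L ε (simpleField p hs hμs φ)) l (𝓝 0))
    (w : TwoScaleField Ω p) : Tendsto (fun ε => L ε w) l (𝓝 0) := by
  refine Lp.induction hp (fun w => Tendsto (fun ε => L ε w) l (𝓝 0)) (fun φ s hs hμs => ?_)
    (fun f g hf hg _ h1 h2 => ?_) (isClosed_setOf_tendsto_zero hC) w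
  · rw [Lp.simpleFunc.coe_indicatorConst]
    exact h s hs hμs.ne φ
  · simpa using h1.add h2

section Simple

variable (M : PeridynamicMedium) {p : ℝ≥0∞} {s : Set E3} (hs : MeasurableSet s)
  (hμs : volume.restrict unitCell s ≠ ∞) (φ : closure M.Ω →ᵇ E3)

open TwoScaleField

theorem enorm_bondIntegral_fluctuation_simple_le [Fact (1 ≤ p)] {ε : ℝ} (hε : 0 < ε) (x : E3) :
    ‖bondIntegral M.longKernel ((simpleField p hs hμs φ).fluctuation ε) x‖ₑ
      ≤ ENNReal.ofReal (M.lam * M.γ ^ 2) * rieszMass * (‖φ‖ₑ + ‖φ‖ₑ) := by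
  refine M.isBondKernel_longKernel.enorm_bondIntegral_le_const M.γ_pos x ?_
  filter_upwards [ae_eval_indicatorConst_rescale (p := p) hs hμs φ hε] with x' hx' _
  rw [fluctuation, rescale, hx', macro_part_indicatorConst]
  refine enorm_sub_le.trans (add_le_add (enorm_indicator_smul_le φ _ _) ?_)
  rw [enorm_smul]
  refine (mul_le_of_le_one_left zero_le ?_).trans (enorm_extendZero_le φ x')
  rw [← ofReal_norm, Real.norm_of_nonneg measureReal_nonneg]
  exact ENNReal.ofReal_le_one.2 measureReal_le_one

/-- Both terms share the fast argument `x'/ε`, so only the variation of `φ` remains. The free bound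
`c` serves twice: `2‖φ‖` for domination, and a small value for the limit. -/
theorem enorm_bondIntegral_slowDiff_simple_le {ε : ℝ} (hε : 0 < ε) {D : Set E3}
    (hD : MeasurableSet D) (x : E3) {c : ℝ≥0∞}
    (hc : ∀ x', ‖x' - x‖ < ε * M.δ → x' ∈ D → ‖extendZero φ x' - extendZero φ x‖ₑ ≤ c) :
    ‖bondIntegral (M.shortKernel ε D) ((simpleField p hs hμs φ).slowDiff ε) x‖ₑ
      ≤ ENNReal.ofReal (M.αmax * M.δ ^ 2) * rieszMass * c := by
  rw [← M.shortKernel_strength hε]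
  refine (M.isBondKernel_shortKernel ε hD).enorm_bondIntegral_le_const (mul_pos hε M.δ_pos) x ?_
  filter_upwards [ae_eval_indicatorConst_rescale (p := p) hs hμs φ hε] with x' hx' hk
  rw [slowDiff, hx', hx', ← smul_sub, enorm_smul]
  obtain ⟨h1, h2⟩ := cutoff_ne_zero hk
  refine (mul_le_of_le_one_left zero_le ?_).trans (hc x' h1 h2)
  by_cases h : cellRep (ε⁻¹ • x') ∈ s <;> simp [h]

theorem ae_enorm_bondIntegral_fastDiff_simple_le {ε : ℝ} (hε : 0 < ε) {D : Set E3}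
    (hD : MeasurableSet D) :
    ∀ᵐ x, ‖bondIntegral (M.shortKernel ε D) ((simpleField p hs hμs φ).fastDiff ε) x‖ₑ
      ≤ ENNReal.ofReal (M.αmax * M.δ ^ 2) * rieszMass * (‖φ‖ₑ + ‖φ‖ₑ) := by
  have h := ae_eval_indicatorConst_rescale (p := p) hs hμs φ hε
  filter_upwards [h] with x hx
  rw [← M.shortKernel_strength hε]
  refine (M.isBondKernel_shortKernel ε hD).enorm_bondIntegral_le_const (mul_pos hε M.δ_pos) x ?_
  filter_upwards [h] with x' hx' _
  rw [fastDiff, hx, hx']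
  exact enorm_sub_le.trans
    (add_le_add (enorm_indicator_smul_le φ _ _) (enorm_indicator_smul_le φ _ _))

/-- For fixed `x` the long range kernel times `φ` is an integrable function of `x'`, against which
`1_s(x'/ε)` minus its cell mean tends weakly to zero. -/
theorem tendsto_bondIntegral_fluctuation_simple (x : E3) :
    Tendsto (fun ε => bondIntegral M.longKernel ((simpleField p hs hμs φ).fluctuation ε) x)
      (𝓝[>] 0) (𝓝 0) := by
  set G : E3 → E3 := bondIntegrand M.longKernel (fun _ x' => extendZero φ x') x with hG
  have hκ := M.isBondKernel_longKernel
  have hφm : Measurable (Function.uncurry fun _ x' : E3 => extendZero φ x') :=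
    (measurable_extendZero φ).comp measurable_snd
  have hGi : Integrable G := hκ.integrable_bondIntegrand_of_bounded M.γ_pos x hφm
    (enorm_ne_top (x := φ)) fun x' => enorm_extendZero_le φ x'
  set m := (volume.restrict unitCell).real s
  have ht := (tendsto_integral_rescale_indicator hs hGi).sub_const (m • ∫ x', G x')
  rw [sub_self] at ht
  refine ht.congr' ?_
  filter_upwards [self_mem_nhdsWithin] with ε hε
  have hi : Integrable fun x' =>
      s.indicator (fun _ => (1 : ℝ)) (cellRep (ε⁻¹ • x')) • G x' := by
    have hsm : Measurable fun x' : E3 => s.indicator (fun _ => (1 : ℝ)) (cellRep (ε⁻¹ • x')) :=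
      (measurable_const.indicator hs).comp
        (measurable_cellRep.comp (measurable_id.const_smul ε⁻¹))
    refine hGi.bdd_smul 1 hsm.aestronglyMeasurable (ae_of_all _ fun x' => ?_)
    by_cases h : cellRep (ε⁻¹ • x') ∈ s <;> simp [h]
  have hi' : Integrable fun x' => m • G x' := hGi.smul m
  rw [← integral_smul, ← integral_sub hi hi', bondIntegral]
  refine integral_congr_ae ?_
  filter_upwards [ae_eval_indicatorConst_rescale (p := p) hs hμs φ hε] with x' hx'
  rw [bondIntegrand, fluctuation, rescale, hx', macro_part_indicatorConst, bondForce_sub,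
    bondForce_smul, bondForce_smul, smul_sub, smul_comm, smul_comm _ m]
  rfl

/-- The horizon `εδ` shrinks to the point `x`, where `φ` is continuous, while the mass of the kernel
stays bounded. -/
theorem tendsto_bondIntegral_slowDiff_simple {x : E3} (hx : x ∈ M.Ω) :
    Tendsto (fun ε => bondIntegral (M.shortKernel ε M.Ω) ((simpleField p hs hμs φ).slowDiff ε) x)
      (𝓝[>] 0) (𝓝 0) := by
  rw [tendsto_zero_iff_enorm_tendsto_zero]
  have hc := continuousAt_extendZero M.isOpen_Ω φ hx
  set A := ENNReal.ofReal (M.αmax * M.δ ^ 2) * rieszMass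
  have hA : A ≠ ∞ := ENNReal.mul_ne_top ENNReal.ofReal_ne_top rieszMass_ne_top
  have hcont : Tendsto (fun x' => ‖extendZero φ x' - extendZero φ x‖ₑ) (𝓝 x) (𝓝 0) := by
    have := hc.tendsto.edist (tendsto_const_nhds (x := extendZero φ x))
    simpa only [edist_self, edist_eq_enorm_sub] using this
  rw [ENNReal.tendsto_nhds_zero]
  intro η hη
  obtain ⟨c, hc0, hcη⟩ : ∃ c, 0 < c ∧ A * c ≤ η := by
    rcases eq_or_ne η ∞ with rfl | hη'
    · exact ⟨1, one_pos, le_top⟩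
    -- Dividing by `A + 1` avoids a separate case for `A = 0`.
    · refine ⟨η / (A + 1), ENNReal.div_pos hη.ne' (by finiteness), ?_⟩
      rw [← mul_div_assoc]
      refine ENNReal.div_le_of_le_mul ?_
      rw [mul_comm]
      gcongr
      exact le_self_add
  obtain ⟨d, hd, hball⟩ := Metric.eventually_nhds_iff.1 (ENNReal.tendsto_nhds_zero.1 hcont c hc0)
  filter_upwards [Ioo_mem_nhdsGT (div_pos hd M.δ_pos)] with ε hε
  refine (enorm_bondIntegral_slowDiff_simple_le M hs hμs φ hε.1 M.measurableSet_Ω x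
    fun x' hx' _ => hball ?_).trans hcη
  rw [dist_eq_norm]
  exact hx'.trans ((lt_div_iff₀ M.δ_pos).1 hε.2)

/-- Once `εδ` is below the radius of a ball about `x` inside `Ω`, no bond from `x` reaches the
complement. This boundary layer effect is pointwise only, so domination is needed to pass to `L¹`.
-/
theorem tendsto_bondIntegral_shortKernel_compl {f : ℝ → E3 → E3 → E3} {x : E3} (hx : x ∈ M.Ω) :
    Tendsto (fun ε => bondIntegral (M.shortKernel ε M.Ωᶜ) (f ε) x) (𝓝[>] 0) (𝓝 0) := by
  obtain ⟨d, hd, hball⟩ := Metric.isOpen_iff.1 M.isOpen_Ω x hx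
  refine tendsto_const_nhds.congr' ?_
  filter_upwards [Ioo_mem_nhdsGT (div_pos hd M.δ_pos)] with ε hε
  have h0 : ∀ x', M.shortKernel ε M.Ωᶜ x x' = 0 := fun x' => by
    by_contra hk
    obtain ⟨h1, h2⟩ := cutoff_ne_zero hk
    exact h2 (hball (mem_ball_iff_norm.2 (h1.trans ((lt_div_iff₀ M.δ_pos).1 hε.2))))
  simp [bondIntegral, bondIntegrand, h0]

end Simple

/-! ### The residual operators and their uniform bounds. -/

/-- The bound of the operators at the scale `ε`. -/
def operatorBound (R A ε : ℝ) : ℝ :=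
  (2 * (ENNReal.ofReal A * rieszMass) * (3 * volume (Metric.ball (0 : E3) (R + ε)))).toReal

theorem operatorBound_mono {R A ε ε' : ℝ} (h : ε ≤ ε') :
    operatorBound R A ε ≤ operatorBound R A ε' := by
  have := rieszMass_ne_top
  have := (measure_ball_lt_top (μ := (volume : Measure E3)) (x := 0) (r := R + ε')).ne
  unfold operatorBound
  refine ENNReal.toReal_mono (by finiteness) ?_
  gcongr

section Residuals

variable (M : PeridynamicMedium) {p : ℝ≥0∞} [Fact (1 ≤ p)] {R : ℝ}

open TwoScaleField

theorem exists_fluctuation_operator (hR : M.Ω ⊆ Metric.ball 0 R) {ε : ℝ} (hε : 0 < ε) :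
    ∃ L : TwoScaleField M.Ω p →L[ℝ] Lp E3 1 (volume.restrict M.Ω),
      (∀ w, L w =ᵐ[volume.restrict M.Ω] bondIntegral M.longKernel (w.fluctuation ε)) ∧
      ‖L‖ ≤ operatorBound (R + M.γ) (M.lam * M.γ ^ 2) ε := by
  refine exists_residual_operator hR M.measurableSet_Ω M.γ_pos le_rfl M.isBondKernel_longKernel hε
    (fun w => w.fluctuation ε) (fun w => w.measurable_fluctuation ε) (fun w w' => ?_)
    (fun c w => ?_) (fun w x x' => w.enorm_fluctuation_le ε x x')
  · refine ae_of_all _ fun x => ?_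
    filter_upwards [ae_eval_add_rescale w w' hε] with x' hx'
    simp only [fluctuation, rescale, hx', macro_part_add]
    abel
  · refine ae_of_all _ fun x => ?_
    filter_upwards [ae_eval_smul_rescale c w hε] with x' hx'
    simp only [fluctuation, rescale, hx', macro_part_smul, smul_sub]

theorem exists_slowDiff_operator (hR : M.Ω ⊆ Metric.ball 0 R) {ε : ℝ} (hε : 0 < ε)
    {r' : ℝ} (hr' : ε * M.δ ≤ r') {D : Set E3} (hD : MeasurableSet D) :
    ∃ L : TwoScaleField M.Ω p →L[ℝ] Lp E3 1 (volume.restrict M.Ω),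
      (∀ w, L w =ᵐ[volume.restrict M.Ω] bondIntegral (M.shortKernel ε D) (w.slowDiff ε)) ∧
      ‖L‖ ≤ operatorBound (R + r') (M.αmax * M.δ ^ 2) ε := by
  rw [← M.shortKernel_strength hε]
  refine exists_residual_operator hR M.measurableSet_Ω (mul_pos hε M.δ_pos) hr'
    (M.isBondKernel_shortKernel ε hD) hε
    (fun w => w.slowDiff ε) (fun w => w.measurable_slowDiff ε) (fun w w' => ?_)
    (fun c w => ?_) (fun w => w.enorm_slowDiff_le ε)
  · refine ae_of_all _ fun x => ?_
    filter_upwards [ae_eval_add_rescale w w' hε] with x' hx'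
    simp only [slowDiff, hx']
    abel
  · refine ae_of_all _ fun x => ?_
    filter_upwards [ae_eval_smul_rescale c w hε] with x' hx'
    simp only [slowDiff, hx', smul_sub]

theorem exists_fastDiff_operator (hR : M.Ω ⊆ Metric.ball 0 R) {ε : ℝ} (hε : 0 < ε)
    {r' : ℝ} (hr' : ε * M.δ ≤ r') {D : Set E3} (hD : MeasurableSet D) :
    ∃ L : TwoScaleField M.Ω p →L[ℝ] Lp E3 1 (volume.restrict M.Ω),
      (∀ w, L w =ᵐ[volume.restrict M.Ω] bondIntegral (M.shortKernel ε D) (w.fastDiff ε)) ∧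
      ‖L‖ ≤ operatorBound (R + r') (M.αmax * M.δ ^ 2) ε := by
  rw [← M.shortKernel_strength hε]
  refine exists_residual_operator hR M.measurableSet_Ω (mul_pos hε M.δ_pos) hr'
    (M.isBondKernel_shortKernel ε hD) hε
    (fun w => w.fastDiff ε) (fun w => w.measurable_fastDiff ε) (fun w w' => ?_)
    (fun c w => ?_) (fun w => w.enorm_fastDiff_le ε)
  · have h := ae_eval_add_rescale w w' hε
    filter_upwards [h] with x hx
    filter_upwards [h] with x' hx'
    simp only [fastDiff, hx', hx]
    abel
  · have h := ae_eval_smul_rescale c w hε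
    filter_upwards [h] with x hx
    filter_upwards [h] with x' hx'
    simp only [fastDiff, hx', hx, smul_sub]

end Residuals

/-- The residual operators at the scale `ε` are uniformly bounded and tend to zero strongly. -/
theorem exists_residual (M : PeridynamicMedium) {p : ℝ≥0∞} [Fact (1 ≤ p)] (hp : p ≠ ∞) {R : ℝ}
    (hR : M.Ω ⊆ Metric.ball 0 R) :
    ∃ (Q : ℝ → TwoScaleField M.Ω p →L[ℝ] Lp E3 1 (volume.restrict M.Ω)) (C : ℝ),
      (∀ ε, 0 < ε → ε ≤ 1 → (∀ w, Q ε w =ᵐ[volume.restrict M.Ω] fun x =>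
        bondIntegral M.longKernel (w.fluctuation ε) x
          + bondIntegral (M.shortKernel ε M.Ω) (w.slowDiff ε) x
          - bondIntegral (M.shortKernel ε M.Ωᶜ) (w.fastDiff ε) x) ∧ ‖Q ε‖ ≤ C) ∧
      ∀ w, Tendsto (fun ε => Q ε w) (𝓝[>] 0) (𝓝 0) := by
  have hδ : ∀ ε, 0 < ε → ε ≤ 1 → ε * M.δ ≤ M.δ := fun ε _ h =>
    mul_le_of_le_one_left M.δ_pos.le h
  have hΩc := M.measurableSet_Ω.compl
  -- The operators are made total in `ε`, with the value `0` outside the relevant range, so that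
  -- they can be chosen as functions of `ε`.
  have e1 : ∀ ε : ℝ, ∃ L : TwoScaleField M.Ω p →L[ℝ] Lp E3 1 (volume.restrict M.Ω), 0 < ε → _ :=
    fun ε => (em (0 < ε)).elim (fun h => (exists_fluctuation_operator M hR h).imp fun _ h _ => h)
      fun h => ⟨0, fun h' => absurd h' h⟩
  have e2 : ∀ ε : ℝ, ∃ L : TwoScaleField M.Ω p →L[ℝ] Lp E3 1 (volume.restrict M.Ω),
      0 < ε ∧ ε ≤ 1 → _ :=
    fun ε => (em (0 < ε ∧ ε ≤ 1)).elim (fun h => (exists_slowDiff_operator M hR h.1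
      (hδ ε h.1 h.2) M.measurableSet_Ω).imp fun _ h _ => h) fun h => ⟨0, fun h' => absurd h' h⟩
  have e3 : ∀ ε : ℝ, ∃ L : TwoScaleField M.Ω p →L[ℝ] Lp E3 1 (volume.restrict M.Ω),
      0 < ε ∧ ε ≤ 1 → _ :=
    fun ε => (em (0 < ε ∧ ε ≤ 1)).elim (fun h => (exists_fastDiff_operator M hR h.1
      (hδ ε h.1 h.2) hΩc).imp fun _ h _ => h) fun h => ⟨0, fun h' => absurd h' h⟩
  choose L₁ h₁ using e1
  choose L₂ h₂ using e2
  choose L₃ h₃ using e3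
  set C := operatorBound (R + M.γ) (M.lam * M.γ ^ 2) 1
    + operatorBound (R + M.δ) (M.αmax * M.δ ^ 2) 1
    + operatorBound (R + M.δ) (M.αmax * M.δ ^ 2) 1
  have hQ : ∀ ε, 0 < ε → ε ≤ 1 → (∀ w, (L₁ ε + L₂ ε - L₃ ε) w =ᵐ[volume.restrict M.Ω] fun x =>
        bondIntegral M.longKernel (w.fluctuation ε) x
          + bondIntegral (M.shortKernel ε M.Ω) (w.slowDiff ε) x
          - bondIntegral (M.shortKernel ε M.Ωᶜ) (w.fastDiff ε) x) ∧
        ‖L₁ ε + L₂ ε - L₃ ε‖ ≤ C := fun ε h0 h1 => by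
    obtain ⟨a1, b1⟩ := h₁ ε h0
    obtain ⟨a2, b2⟩ := h₂ ε ⟨h0, h1⟩
    obtain ⟨a3, b3⟩ := h₃ ε ⟨h0, h1⟩
    refine ⟨fun w => ?_, ?_⟩
    · simp only [sub_apply, add_apply]
      filter_upwards [a1 w, a2 w, a3 w, Lp.coeFn_sub (L₁ ε w + L₂ ε w) (L₃ ε w),
        Lp.coeFn_add (L₁ ε w) (L₂ ε w)] with x c1 c2 c3 c4 c5
      rw [c4, Pi.sub_apply, c5, Pi.add_apply, c1, c2, c3]
    · refine (norm_sub_le (L₁ ε + L₂ ε) (L₃ ε)).trans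
        (add_le_add ((norm_add_le (L₁ ε) (L₂ ε)).trans (add_le_add ?_ ?_)) ?_)
      · exact b1.trans (operatorBound_mono h1)
      · exact b2.trans (operatorBound_mono h1)
      · exact b3.trans (operatorBound_mono h1)
  have hsmall : ∀ᶠ ε : ℝ in 𝓝[>] 0, 0 < ε ∧ ε ≤ 1 := by
    filter_upwards [Ioo_mem_nhdsGT one_pos] with ε hε using ⟨hε.1, hε.2.le⟩
  refine ⟨fun ε => L₁ ε + L₂ ε - L₃ ε, C, hQ, fun w => ?_⟩
  have : IsFiniteMeasure (volume.restrict M.Ω) :=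
    isFiniteMeasure_restrict.2 M.isBounded_Ω.measure_lt_top.ne
  have hMass := rieszMass_ne_top
  refine TwoScaleField.tendsto_zero_of_simple hp (C := C)
    (hsmall.mono fun ε h => (hQ ε h.1 h.2).2) (fun s hs hμs φ => ?_) w
  refine tendsto_L1_zero_of_bounded
    (C := ENNReal.ofReal (M.lam * M.γ ^ 2) * rieszMass * (‖φ‖ₑ + ‖φ‖ₑ)
      + ENNReal.ofReal (M.αmax * M.δ ^ 2) * rieszMass * (‖φ‖ₑ + ‖φ‖ₑ)
      + ENNReal.ofReal (M.αmax * M.δ ^ 2) * rieszMass * (‖φ‖ₑ + ‖φ‖ₑ)) (by finiteness)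
    (hsmall.mono fun ε h => (hQ ε h.1 h.2).1 _) ?_ ?_
  · filter_upwards [hsmall] with ε hε
    filter_upwards [ae_restrict_of_ae
      (ae_enorm_bondIntegral_fastDiff_simple_le M (p := p) hs hμs φ hε.1 hΩc)] with x hx
    refine enorm_sub_le.trans (add_le_add (enorm_add_le _ _ |>.trans (add_le_add ?_ ?_)) hx)
    · exact enorm_bondIntegral_fluctuation_simple_le M hs hμs φ hε.1 x
    · exact enorm_bondIntegral_slowDiff_simple_le M hs hμs φ hε.1 M.measurableSet_Ω x
        fun x' _ _ => enorm_sub_le.trans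
          (add_le_add (TwoScaleField.enorm_extendZero_le φ _)
            (TwoScaleField.enorm_extendZero_le φ _))
  · filter_upwards [ae_restrict_mem M.measurableSet_Ω] with x hx
    simpa using ((tendsto_bondIntegral_fluctuation_simple M (p := p) hs hμs φ x).add
      (tendsto_bondIntegral_slowDiff_simple M (p := p) hs hμs φ hx)).sub
      (tendsto_bondIntegral_shortKernel_compl M
        (f := fun ε => (TwoScaleField.simpleField p hs hμs φ).fastDiff ε) hx)

/-! ### The rescaled two-scale equation -/

/-- A lattice translation carries the ball about the representative of `x/ε` to the ball about
`x/ε`, and the dilation `y' = x'/ε` carries that to the `εδ`-ball about `x`. The domain is the whole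
space because the cell integral ignores `Ω`. -/
theorem integral_ball_cellRep_eq_bondIntegral (M : PeridynamicMedium) {p : ℝ≥0∞}
    (w : TwoScaleField M.Ω p) {ε : ℝ} (hε : 0 < ε) (x : E3) :
    ∫ y' in Metric.ball (cellRep (ε⁻¹ • x)) M.δ, M.α (cellRep (ε⁻¹ • x)) y' •
        bondForce (y' - cellRep (ε⁻¹ • x)) (w.eval x y' - w.eval x (cellRep (ε⁻¹ • x)))
      = bondIntegral (M.shortKernel ε univ) (w.fastDiff ε) x := by
  obtain ⟨k, hk⟩ := exists_cellRep_eq_add (ε⁻¹ • x)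
  set z := ε⁻¹ • x with hz
  set g : E3 → E3 := fun y' => M.α z y' • bondForce (y' - z) (w.eval x y' - w.eval x z)
  have hev : ∀ y, w.eval x (y + latticeVec k) = w.eval x y := fun y => by
    rw [← w.eval_cellRep, cellRep_add_latticeVec, w.eval_cellRep]
  have h1 : ∫ y' in Metric.ball (cellRep z) M.δ, M.α (cellRep z) y' •
        bondForce (y' - cellRep z) (w.eval x y' - w.eval x (cellRep z))
      = ∫ y' in Metric.ball z M.δ, g y' := by
    rw [hk, ← integral_indicator Metric.isOpen_ball.measurableSet,
      ← integral_indicator Metric.isOpen_ball.measurableSet,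
      ← integral_add_right_eq_self _ (latticeVec k)]
    refine integral_congr_ae (ae_of_all _ fun y' => ?_)
    have hmem : y' + latticeVec k ∈ Metric.ball (z + latticeVec k) M.δ ↔
        y' ∈ Metric.ball z M.δ := by
      rw [mem_ball_iff_norm, mem_ball_iff_norm, add_sub_add_right_eq_sub]
    by_cases h : y' ∈ Metric.ball z M.δ
    · simp only [indicator_of_mem h, indicator_of_mem (hmem.2 h), g, hev,
        M.α_cellRep_add_latticeVec, add_sub_add_right_eq_sub]
    · simp only [indicator_of_notMem h, indicator_of_notMem (fun h' => h (hmem.1 h'))]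
  rw [h1, PeridynamicMedium.shortKernel, bondIntegral_cutoff MeasurableSet.univ, inter_univ]
  have h2 := Measure.setIntegral_comp_smul_of_pos volume g (Metric.ball x (ε * M.δ))
    (inv_pos.2 hε)
  rw [smul_ball (inv_ne_zero hε.ne'), Real.norm_of_nonneg (inv_nonneg.2 hε.le),
    inv_mul_cancel_left₀ hε.ne', ← hz, finrank_euclideanSpace, Fintype.card_fin] at h2
  have h3 : ∫ y' in Metric.ball z M.δ, g y'
      = (ε ^ 3)⁻¹ • ∫ x' in Metric.ball x (ε * M.δ), g (ε⁻¹ • x') := by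
    rw [h2, smul_smul, ← inv_pow, mul_inv_cancel₀ (by positivity), one_smul]
  rw [h3, ← integral_smul]
  refine integral_congr_ae (ae_of_all _ fun x' => ?_)
  simp only [g, TwoScaleField.fastDiff, ← hz]
  rw [hz, ← smul_sub, bondForce_smul_left (inv_pos.2 hε), smul_smul, smul_smul]
  congr 1
  field_simp

/-- The points `(x, x/ε)` form a null set in the product. The substitution is legitimate because the
equation holds, for almost every `y`, at every `x`. -/
theorem IsTwoScaleSolution.ae_equation_rescale {M : PeridynamicMedium} {p : ℝ≥0∞}
    [Fact (1 ≤ p)] {T : ℝ} {u₀ v₀ : TwoScaleField M.Ω p} {b u : ℝ → TwoScaleField M.Ω p}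
    (hu : IsTwoScaleSolution M T u₀ v₀ b u) {t : ℝ} (ht : t ∈ Icc 0 T) {ε : ℝ} (hε : 0 < ε) :
    ∀ᵐ x ∂(volume.restrict M.Ω),
      M.ρ (ε⁻¹ • x) • TwoScaleField.rescale ε (iteratedDerivWithin 2 u (Icc 0 T) t) x =
        bondIntegral M.longKernel (fun x x' => (u t).macro_part x' - (u t).rescale ε x) x
        + bondIntegral (M.shortKernel ε univ) ((u t).fastDiff ε) x + (b t).rescale ε x := by
  filter_upwards [ae_restrict_of_ae (ae_cellRep_of_ae (hu.equation t ht) hε),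
    ae_restrict_mem M.measurableSet_Ω] with x hx hxΩ
  have h := hx x (subset_closure hxΩ)
  rw [integral_ball_cellRep_eq_bondIntegral M (u t) hε x, M.ρ_cellRep] at h
  simp only [TwoScaleField.eval_cellRep] at h
  rw [PeridynamicMedium.longKernel, bondIntegral_cutoff M.measurableSet_Ω]
  exact h

theorem IsPeridynamicSolution.ae_equation {M : PeridynamicMedium} {p : ℝ≥0∞}
    [Fact (1 ≤ p)] {T : ℝ} {u₀ v₀ : TwoScaleField M.Ω p} {b : ℝ → TwoScaleField M.Ω p} {ε : ℝ}
    {u : ℝ → BodyField M.Ω p} (hu : IsPeridynamicSolution M T u₀ v₀ b ε u) {t : ℝ}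
    (ht : t ∈ Icc 0 T) :
    ∀ᵐ x ∂(volume.restrict M.Ω), M.ρ (ε⁻¹ • x) • iteratedDerivWithin 2 u (Icc 0 T) t x =
        bondIntegral M.longKernel (fun x x' => u t x' - u t x) x
        + bondIntegral (M.shortKernel ε M.Ω) (fun x x' => u t x' - u t x) x
        + (b t).rescale ε x := by
  filter_upwards [hu.equation t ht] with x hx
  rw [PeridynamicMedium.longKernel, bondIntegral_cutoff M.measurableSet_Ω,
    PeridynamicMedium.shortKernel, bondIntegral_cutoff M.measurableSet_Ω]
  exact hx

theorem bondIntegral_cutoff_congr_ae {Ω : Set E3} (hΩ : MeasurableSet Ω) (r : ℝ)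
    (a : E3 → E3 → ℝ) {f g : E3 → E3} (hfg : f =ᵐ[volume.restrict Ω] g) :
    bondIntegral (cutoff Ω r a) (fun x x' => f x' - f x)
      =ᵐ[volume.restrict Ω] bondIntegral (cutoff Ω r a) fun x x' => g x' - g x := by
  have h := (ae_restrict_iff' hΩ).1 hfg
  filter_upwards [hfg] with x hx
  refine integral_congr_ae ?_
  filter_upwards [h] with x' hx'
  by_cases hk : cutoff Ω r a x x' = 0
  · simp [bondIntegrand, hk]
  · rw [bondIntegrand, bondIntegrand, hx, hx' (cutoff_ne_zero hk).2]

section Splitting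

variable (M : PeridynamicMedium) {p : ℝ≥0∞} [Fact (1 ≤ p)] {R : ℝ}
  (w : TwoScaleField M.Ω p) {ε : ℝ}


theorem enorm_le_majorant_of_cutoff {r : ℝ} {D : Set E3} {a : E3 → E3 → ℝ}
    (hR : M.Ω ⊆ Metric.ball 0 R) {x x' : E3} (hx : x ∈ M.Ω) (hk : cutoff D r a x x' ≠ 0)
    {v : E3} (hv : ‖v‖ₑ ≤ (2 * ‖w (cellRep (ε⁻¹ • x))‖ₑ + ‖w‖ₑ)
      + (2 * ‖w (cellRep (ε⁻¹ • x'))‖ₑ + ‖w‖ₑ)) :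
    ‖v‖ₑ ≤ w.majorant (R + r) ε x + w.majorant (R + r) ε x' := by
  have h1 : ‖x‖ < R := by simpa using hR hx
  have h2 := (cutoff_ne_zero hk).1
  have h3 : ‖x'‖ ≤ ‖x' - x‖ + ‖x‖ := by simpa using norm_add_le (x' - x) x
  have h4 := norm_nonneg (x' - x)
  exact hv.trans (add_le_add (w.le_majorant (by linarith)) (w.le_majorant (by linarith)))

theorem lintegral_majorant_ne_top (hε : 0 < ε) (R : ℝ) : ∫⁻ x, w.majorant R ε x ≠ ∞ := by
  have := (measure_ball_lt_top (μ := (volume : Measure E3)) (x := 0) (r := R + ε)).ne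
  exact ne_top_of_le_ne_top (by finiteness) (w.lintegral_majorant_le R hε)

theorem ae_bondIntegral_long_split (hR : M.Ω ⊆ Metric.ball 0 R) (hε : 0 < ε) :
    bondIntegral M.longKernel (fun x x' => w.rescale ε x' - w.rescale ε x)
      =ᵐ[volume.restrict M.Ω]
        bondIntegral M.longKernel (fun x x' => w.macro_part x' - w.rescale ε x)
          + bondIntegral M.longKernel (w.fluctuation ε) := by
  have hm := w.measurable_majorant (R + M.γ) ε
  have hi := lintegral_majorant_ne_top M w hε (R + M.γ)
  refine M.isBondKernel_longKernel.ae_bondIntegral_add M.γ_pos M.measurableSet_Ω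
    ((w.measurable_macro_part.comp measurable_snd).sub
      ((w.measurable_rescale ε).comp measurable_fst)) (w.measurable_fluctuation ε) hm hm hi hi
    (fun x hx x' hk => enorm_le_majorant_of_cutoff M w hR hx hk ?_)
    (fun x hx x' hk => enorm_le_majorant_of_cutoff M w hR hx hk (w.enorm_fluctuation_le ε x x'))
    (ae_of_all _ fun x => ae_of_all _ fun x' _ => ?_)
  · calc _ ≤ ‖w‖ₑ + 1 * ‖w (cellRep (ε⁻¹ • x))‖ₑ := by
          rw [one_mul]
          exact enorm_sub_le.trans (add_le_add (w.enorm_macro_part_le _) (w.enorm_eval_le _ _))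
      _ ≤ ‖w‖ₑ + 2 * ‖w (cellRep (ε⁻¹ • x))‖ₑ := by gcongr; exact one_le_two
      _ = 2 * ‖w (cellRep (ε⁻¹ • x))‖ₑ + ‖w‖ₑ := add_comm _ _
      _ ≤ _ := le_self_add
  · simp only [TwoScaleField.fluctuation]; abel

theorem ae_bondIntegral_short_split (hR : M.Ω ⊆ Metric.ball 0 R) (hε : 0 < ε) :
    bondIntegral (M.shortKernel ε M.Ω) (fun x x' => w.rescale ε x' - w.rescale ε x)
      =ᵐ[volume.restrict M.Ω] bondIntegral (M.shortKernel ε M.Ω) (w.fastDiff ε)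
          + bondIntegral (M.shortKernel ε M.Ω) (w.slowDiff ε) := by
  have hm := w.measurable_majorant (R + ε * M.δ) ε
  have hi := lintegral_majorant_ne_top M w hε (R + ε * M.δ)
  refine (M.isBondKernel_shortKernel ε M.measurableSet_Ω).ae_bondIntegral_add
    (mul_pos hε M.δ_pos) M.measurableSet_Ω (w.measurable_fastDiff ε) (w.measurable_slowDiff ε)
    hm hm hi hi
    (fun x hx x' hk => enorm_le_majorant_of_cutoff M w hR hx hk (w.enorm_fastDiff_le ε x x'))
    (fun x hx x' hk => enorm_le_majorant_of_cutoff M w hR hx hk (w.enorm_slowDiff_le ε x x'))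
    (ae_of_all _ fun x => ae_of_all _ fun x' _ => ?_)
  simp only [TwoScaleField.fastDiff, TwoScaleField.slowDiff, TwoScaleField.rescale]; abel

/-- The cell problem uses all bonds and the physical problem only those inside `Ω`; the difference
is the boundary term of the residual. -/
theorem ae_bondIntegral_domain_split (hR : M.Ω ⊆ Metric.ball 0 R) (hε : 0 < ε) :
    bondIntegral (M.shortKernel ε univ) (w.fastDiff ε)
      =ᵐ[volume.restrict M.Ω] bondIntegral (M.shortKernel ε M.Ω) (w.fastDiff ε)
          + bondIntegral (M.shortKernel ε M.Ωᶜ) (w.fastDiff ε) := by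
  have hm := w.measurable_majorant (R + ε * M.δ) ε
  have hi := lintegral_majorant_ne_top M w hε (R + ε * M.δ)
  have hint : ∀ D : Set E3, MeasurableSet D → ∀ᵐ x ∂(volume.restrict M.Ω),
      Integrable (bondIntegrand (M.shortKernel ε D) (w.fastDiff ε) x) := fun D hD =>
    (M.isBondKernel_shortKernel ε hD).ae_integrable_bondIntegrand (mul_pos hε M.δ_pos)
      M.measurableSet_Ω (w.measurable_fastDiff ε) hm hi
      (fun x hx x' hk => enorm_le_majorant_of_cutoff M w hR hx hk (w.enorm_fastDiff_le ε x x'))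
  filter_upwards [hint _ M.measurableSet_Ω, hint _ M.measurableSet_Ω.compl] with x h1 h2
  rw [Pi.add_apply, bondIntegral, bondIntegral, bondIntegral, ← integral_add h1 h2]
  refine integral_congr_ae (ae_of_all _ fun x' => ?_)
  simp only [bondIntegrand, ← add_smul]
  congr 1
  by_cases hx' : x' ∈ M.Ω <;> simp [PeridynamicMedium.shortKernel, cutoff, indicator, hx']

end Splitting

/-! ### The error equation and Gronwall's inequality -/

/-- Hölder's inequality on a body of finite volume. -/
theorem exists_inclusion_operator {Ω : Set E3} {p : ℝ≥0∞} [Fact (1 ≤ p)]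
    (hΩ : volume Ω ≠ ∞) :
    ∃ I : BodyField Ω p →L[ℝ] Lp E3 1 (volume.restrict Ω), ∀ w, I w =ᵐ[volume.restrict Ω] w := by
  have h1p : (1 : ℝ≥0∞) ≤ p := Fact.out
  obtain ⟨I, hI, -⟩ := exists_continuousLinearMap_L1 (X := BodyField Ω p)
    (μ := volume.restrict Ω) (C := volume Ω ^ (1 / (1 : ℝ≥0∞).toReal - 1 / p.toReal))
    (fun w => w) (fun w => Lp.aestronglyMeasurable w) Lp.coeFn_add Lp.coeFn_smul
    (ENNReal.rpow_ne_top_of_nonneg (by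
      rcases eq_or_ne p ∞ with rfl | hp
      · simp
      · have h1 : 1 ≤ p.toReal := by simpa using ENNReal.toReal_mono hp h1p
        have h2 : 1 / p.toReal ≤ 1 := by rw [div_le_one (by linarith)]; exact h1
        simpa using h2) hΩ) fun w => by
      rw [← eLpNorm_one_eq_lintegral_enorm, Lp.enorm_def, mul_comm]
      simpa using eLpNorm_le_eLpNorm_mul_rpow_measure_univ h1p (Lp.aestronglyMeasurable w)
  exact ⟨I, hI⟩

/-- The algebra behind the error equation. -/
theorem error_identity {Z : Type*} [AddCommGroup Z] [Module ℝ Z] {ρ : ℝ}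
    {d d' dI dS e b U₁ U₂ A B k₁ k₁' k₂ k₂' K₁ K₂ S₁ S₂ KK q tot Fl Sl Fi Fo : Z}
    (h₁ : ρ • d = U₁ + U₂ + b) (h₂ : ρ • d' = A + B + b) (h₃ : dI = d) (h₄ : dS = d')
    (h₅ : e = dI - dS) (h₆ : tot = KK + q) (h₇ : KK = K₁ + K₂) (h₈ : K₁ = k₁ - k₁')
    (h₉ : K₂ = k₂ - k₂') (h₁₀ : k₁ = U₁) (h₁₁ : k₁' = S₁) (h₁₂ : k₂ = U₂) (h₁₃ : k₂' = S₂)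
    (h₁₄ : q = Fl + Sl - Fo) (h₁₅ : S₁ = A + Fl) (h₁₆ : S₂ = Fi + Sl) (h₁₇ : B = Fi + Fo) :
    tot = ρ • e := by
  subst h₃ h₄ h₅ h₇ h₈ h₉ h₁₀ h₁₁ h₁₂ h₁₃ h₁₄ h₁₅ h₁₆ h₁₇
  rw [h₆, smul_sub, h₁, h₂]
  abel

/-- Subtracting the two equations removes the body force, and the three splittings collect what is
left: `ρ` times the second derivative of the error is the bond force of the error plus the residual.
Since `ρ` is bounded below, it can be divided out. -/
theorem norm_error_deriv_le {M : PeridynamicMedium} {p : ℝ≥0∞} [Fact (1 ≤ p)] {R : ℝ}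
    (hR : M.Ω ⊆ Metric.ball 0 R) {T : ℝ} {u₀ v₀ : TwoScaleField M.Ω p}
    {b u : ℝ → TwoScaleField M.Ω p} (hu : IsTwoScaleSolution M T u₀ v₀ b u) {ε : ℝ} (hε : 0 < ε)
    {uε : ℝ → BodyField M.Ω p} (huε : IsPeridynamicSolution M T u₀ v₀ b ε uε)
    {I : BodyField M.Ω p →L[ℝ] Lp E3 1 (volume.restrict M.Ω)}
    (hI : ∀ w, I w =ᵐ[volume.restrict M.Ω] w)
    {S Q : TwoScaleField M.Ω p →L[ℝ] Lp E3 1 (volume.restrict M.Ω)}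
    (hS : ∀ w, S w =ᵐ[volume.restrict M.Ω] w.rescale ε)
    (hQ : ∀ w, Q w =ᵐ[volume.restrict M.Ω] fun x =>
        bondIntegral M.longKernel (w.fluctuation ε) x
          + bondIntegral (M.shortKernel ε M.Ω) (w.slowDiff ε) x
          - bondIntegral (M.shortKernel ε M.Ωᶜ) (w.fastDiff ε) x)
    {K₁ K₂ : Lp E3 1 (volume.restrict M.Ω) →L[ℝ] Lp E3 1 (volume.restrict M.Ω)}
    (hK₁ : ∀ f, K₁ f =ᵐ[volume.restrict M.Ω] bondIntegral M.longKernel fun x x' => f x' - f x)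
    (hK₂ : ∀ f, K₂ f =ᵐ[volume.restrict M.Ω]
      bondIntegral (M.shortKernel ε M.Ω) fun x x' => f x' - f x)
    {s : ℝ} (hs : s ∈ Icc 0 T) :
    ‖I (iteratedDerivWithin 2 uε (Icc 0 T) s) - S (iteratedDerivWithin 2 u (Icc 0 T) s)‖
      ≤ M.ρmin⁻¹ * ‖K₁ (I (uε s) - S (u s)) + K₂ (I (uε s) - S (u s)) + Q (u s)‖ := by
  set d := iteratedDerivWithin 2 uε (Icc 0 T) s
  set d' := iteratedDerivWithin 2 u (Icc 0 T) s
  rw [map_sub, map_sub]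
  refine Lp.norm_le_mul_norm_of_ae_le_mul ?_
  have k1 : K₁ (I (uε s)) =ᵐ[volume.restrict M.Ω]
      bondIntegral M.longKernel fun x x' => uε s x' - uε s x :=
    (hK₁ _).trans (bondIntegral_cutoff_congr_ae M.measurableSet_Ω _ _ (hI (uε s)))
  have k2 : K₁ (S (u s)) =ᵐ[volume.restrict M.Ω]
      bondIntegral M.longKernel fun x x' => (u s).rescale ε x' - (u s).rescale ε x :=
    (hK₁ _).trans (bondIntegral_cutoff_congr_ae M.measurableSet_Ω _ _ (hS (u s)))
  have k3 : K₂ (I (uε s)) =ᵐ[volume.restrict M.Ω]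
      bondIntegral (M.shortKernel ε M.Ω) fun x x' => uε s x' - uε s x :=
    (hK₂ _).trans (bondIntegral_cutoff_congr_ae M.measurableSet_Ω _ _ (hI (uε s)))
  have k4 : K₂ (S (u s)) =ᵐ[volume.restrict M.Ω]
      bondIntegral (M.shortKernel ε M.Ω) fun x x' => (u s).rescale ε x' - (u s).rescale ε x :=
    (hK₂ _).trans (bondIntegral_cutoff_congr_ae M.measurableSet_Ω _ _ (hS (u s)))
  filter_upwards [hI d, hS d', Lp.coeFn_sub (I d) (S d'),
    k1, k2, k3, k4, hQ (u s),
    Lp.coeFn_sub (K₁ (I (uε s))) (K₁ (S (u s))), Lp.coeFn_sub (K₂ (I (uε s))) (K₂ (S (u s))),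
    Lp.coeFn_add (K₁ (I (uε s)) - K₁ (S (u s))) (K₂ (I (uε s)) - K₂ (S (u s))),
    Lp.coeFn_add (K₁ (I (uε s)) - K₁ (S (u s)) + (K₂ (I (uε s)) - K₂ (S (u s)))) (Q (u s)),
    huε.ae_equation hs, hu.ae_equation_rescale hs hε,
    ae_bondIntegral_long_split M (u s) hR hε, ae_bondIntegral_short_split M (u s) hR hε,
    ae_bondIntegral_domain_split M (u s) hR hε]
    with x a1 a2 a3 a4 a5 a6 a7 a8 a9 a10 a11 a12 q1 q2 s1 s2 s3
  have hρ := M.ρmin_pos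
  have hkey : (K₁ (I (uε s)) - K₁ (S (u s)) + (K₂ (I (uε s)) - K₂ (S (u s))) + Q (u s)) x
      = M.ρ (ε⁻¹ • x) • (I d - S d') x := by
    simp only [Pi.add_apply, Pi.sub_apply] at s1 s2 s3 a3 a9 a10 a11 a12
    exact error_identity q1 q2 a1 a2 a3 a12 a11 a9 a10 a4 a5 a6 a7 a8 s1 s2 s3
  rw [hkey, norm_smul, ← mul_assoc]
  refine le_mul_of_one_le_left (norm_nonneg _) ?_
  rw [inv_mul_eq_div, one_le_div hρ, Real.norm_eq_abs]
  exact (M.ρmin_le _).trans (le_abs_self _)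

theorem hasDerivWithinAt_of_contDiffOn_two {Z : Type*} [NormedAddCommGroup Z] [NormedSpace ℝ Z]
    {T : ℝ} (hT : 0 < T) {f : ℝ → Z} (hf : ContDiffOn ℝ 2 f (Icc 0 T)) {s : ℝ}
    (hs : s ∈ Icc 0 T) :
    HasDerivWithinAt f (derivWithin f (Icc 0 T) s) (Icc 0 T) s ∧
      HasDerivWithinAt (derivWithin f (Icc 0 T)) (iteratedDerivWithin 2 f (Icc 0 T) s)
        (Icc 0 T) s := by
  refine ⟨(hf.differentiableOn two_ne_zero s hs).hasDerivWithinAt, ?_⟩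
  have h := (hf.differentiableOn_iteratedDerivWithin (m := 1) (by norm_num)
    (uniqueDiffOn_Icc hT) s hs).hasDerivWithinAt
  rw [← iteratedDerivWithin_succ, iteratedDerivWithin_one] at h
  exact h

/-- Gronwall's inequality for a second order equation with vanishing initial data. -/
theorem norm_le_gronwallBound_of_second_order {Z : Type*} [NormedAddCommGroup Z] [NormedSpace ℝ Z]
    {T K η : ℝ} {e e' e'' : ℝ → Z} (hη : 0 ≤ η)
    (h1 : ∀ s ∈ Icc 0 T, HasDerivWithinAt e (e' s) (Icc 0 T) s)
    (h2 : ∀ s ∈ Icc 0 T, HasDerivWithinAt e' (e'' s) (Icc 0 T) s)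
    (h3 : e 0 = 0) (h4 : e' 0 = 0) (h5 : ∀ s ∈ Icc 0 T, ‖e'' s‖ ≤ K * ‖e s‖ + η) :
    ∀ t ∈ Icc 0 T, ‖e t‖ ≤ gronwallBound 0 (max 1 K) η t := by
  -- Reduction to first order in the sup norm of the pair. The first component needs the rate `1`
  -- and the second the rate `K`, hence `max 1 K`.
  have hd : ∀ s ∈ Icc 0 T, HasDerivWithinAt (fun s => (e s, e' s)) (e' s, e'' s) (Icc 0 T) s :=
    fun s hs => (h1 s hs).prodMk (h2 s hs)
  have h := norm_le_gronwallBound_of_norm_deriv_right_le (f := fun s => (e s, e' s))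
    (f' := fun s => (e' s, e'' s)) (δ := 0) (K := max 1 K) (ε := η) (a := 0) (b := T)
    (fun s hs => (hd s hs).continuousWithinAt)
    (fun s hs => (hd s (Ico_subset_Icc_self hs)).mono_of_mem_nhdsWithin
      (Icc_mem_nhdsGE_of_mem hs))
    (by simp [h3, h4]) fun s hs => by
      have hK : (1 : ℝ) ≤ max 1 K := le_max_left _ _
      have m1 : ‖e s‖ ≤ ‖(e s, e' s)‖ := le_max_left _ _
      have m2 : ‖e' s‖ ≤ ‖(e s, e' s)‖ := le_max_right _ _
      refine max_le ?_ ?_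
      · calc ‖e' s‖ ≤ 1 * ‖(e s, e' s)‖ := by rw [one_mul]; exact m2
          _ ≤ max 1 K * ‖(e s, e' s)‖ + η := by
            have := mul_le_mul_of_nonneg_right hK (norm_nonneg (e s, e' s))
            linarith
      · calc ‖e'' s‖ ≤ K * ‖e s‖ + η := h5 s (Ico_subset_Icc_self hs)
          _ ≤ max 1 K * ‖(e s, e' s)‖ + η := by
            gcongr
            exact le_max_right _ _
  intro t ht
  have h6 := h t ht
  rw [sub_zero] at h6
  exact (le_max_left _ _).trans h6

/-- The strong two-scale convergence of the peridynamic solutions in `L¹`. -/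
theorem tendsto_error_zero {M : PeridynamicMedium} {p : ℝ≥0∞} [Fact (1 ≤ p)] (hp : p ≠ ∞)
    {R : ℝ} (hR : M.Ω ⊆ Metric.ball 0 R) {T : ℝ} (hT : 0 < T) {u₀ v₀ : TwoScaleField M.Ω p}
    {b u : ℝ → TwoScaleField M.Ω p} (hu : IsTwoScaleSolution M T u₀ v₀ b u)
    {uε : ℝ → ℝ → BodyField M.Ω p}
    (huε : ∀ ε : ℝ, 0 < ε → IsPeridynamicSolution M T u₀ v₀ b ε (uε ε))
    {I : BodyField M.Ω p →L[ℝ] Lp E3 1 (volume.restrict M.Ω)}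
    (hI : ∀ w, I w =ᵐ[volume.restrict M.Ω] w)
    {S : ℝ → TwoScaleField M.Ω p →L[ℝ] Lp E3 1 (volume.restrict M.Ω)}
    (hS : ∀ ε, 0 < ε → ∀ w, S ε w =ᵐ[volume.restrict M.Ω] w.rescale ε)
    {t : ℝ} (ht : t ∈ Icc 0 T) :
    Tendsto (fun ε => I (uε ε t) - S ε (u t)) (𝓝[>] 0) (𝓝 0) := by
  obtain ⟨Q, C, hQ, hQ0⟩ := exists_residual M hp hR
  obtain ⟨K₁, hK₁, -⟩ := exists_bond_operator M.measurableSet_Ω M.γ_pos M.isBondKernel_longKernel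
  set CK := (2 * (ENNReal.ofReal (M.αmax * M.δ ^ 2) * rieszMass) * 1).toReal with hCK
  set K := M.ρmin⁻¹ * (‖K₁‖ + CK) with hK
  have hρ := M.ρmin_pos
  have hsmall : ∀ᶠ ε : ℝ in 𝓝[>] 0, 0 < ε ∧ ε ≤ 1 := by
    filter_upwards [Ioo_mem_nhdsGT one_pos] with ε hε using ⟨hε.1, hε.2.le⟩
  -- The residual is small for each fixed field; compactness of the trajectory makes it small
  -- uniformly in time, as Gronwall requires.
  have hcpt : IsCompact (u '' Icc 0 T) := isCompact_Icc.image_of_continuousOn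
    hu.contDiffOn.continuousOn
  have hunif : ∀ η > 0, ∀ᶠ ε in 𝓝[>] 0, ∀ w ∈ u '' Icc 0 T, ‖Q ε w‖ ≤ η := fun η hη =>
    eventually_forall_norm_le_of_isCompact (hsmall.mono fun ε h => (hQ ε h.1 h.2).2) hcpt
      (fun w _ => hQ0 w) hη
  have key : ∀ ε, 0 < ε → ε ≤ 1 → ∀ η, 0 ≤ η → (∀ w ∈ u '' Icc 0 T, ‖Q ε w‖ ≤ η) →
      ‖I (uε ε t) - S ε (u t)‖ ≤ gronwallBound 0 (max 1 K) (M.ρmin⁻¹ * η) t := by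
    intro ε hε hε1 η hη hηQ
    obtain ⟨K₂, hK₂, hK₂n⟩ := exists_bond_operator M.measurableSet_Ω (mul_pos hε M.δ_pos)
      (M.isBondKernel_shortKernel ε M.measurableSet_Ω)
    -- The operator `K₂` depends on `ε`, but its bound `CK` does not, so the Gronwall rate is fixed.
    rw [M.shortKernel_strength hε, ← hCK] at hK₂n
    have hder : ∀ {Y : Type _} [NormedAddCommGroup Y] [NormedSpace ℝ Y]
        (L : Y →L[ℝ] Lp E3 1 (volume.restrict M.Ω)) {f : ℝ → Y} {f' : Y} {s : ℝ},
        HasDerivWithinAt f f' (Icc 0 T) s →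
          HasDerivWithinAt (fun s => L (f s)) (L f') (Icc 0 T) s :=
      fun L _ _ s h => L.hasFDerivAt.comp_hasDerivWithinAt s h
    have h0 : (0 : ℝ) ∈ Icc 0 T := ⟨le_rfl, hT.le⟩
    refine norm_le_gronwallBound_of_second_order (T := T)
      (e := fun s => I (uε ε s) - S ε (u s))
      (e' := fun s => I (derivWithin (uε ε) (Icc 0 T) s) - S ε (derivWithin u (Icc 0 T) s))
      (e'' := fun s => I (iteratedDerivWithin 2 (uε ε) (Icc 0 T) s)
        - S ε (iteratedDerivWithin 2 u (Icc 0 T) s)) (by positivity)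
      (fun s hs => (hder I (hasDerivWithinAt_of_contDiffOn_two hT (huε ε hε).contDiffOn hs).1).sub
        (hder (S ε) (hasDerivWithinAt_of_contDiffOn_two hT hu.contDiffOn hs).1))
      (fun s hs => (hder I (hasDerivWithinAt_of_contDiffOn_two hT (huε ε hε).contDiffOn hs).2).sub
        (hder (S ε) (hasDerivWithinAt_of_contDiffOn_two hT hu.contDiffOn hs).2))
      ?_ ?_ (fun s hs => ?_) t ht
    · rw [sub_eq_zero, hu.initial]
      exact Lp.ext (((hI _).trans (huε ε hε).initial).trans (hS ε hε u₀).symm)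
    · rw [sub_eq_zero, hu.initial_deriv]
      exact Lp.ext (((hI _).trans (huε ε hε).initial_deriv).trans (hS ε hε v₀).symm)
    · refine (norm_error_deriv_le hR hu hε (huε ε hε) hI (hS ε hε)
        (hQ ε hε hε1).1 hK₁ hK₂ hs).trans ?_
      set e := I (uε ε s) - S ε (u s)
      have hb : ‖K₁ e + K₂ e + Q ε (u s)‖ ≤ (‖K₁‖ + CK) * ‖e‖ + η := by
        refine (norm_add_le _ _).trans (add_le_add ((norm_add_le _ _).trans ?_)
          (hηQ _ (mem_image_of_mem u hs)))
        rw [add_mul]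
        exact add_le_add (K₁.le_opNorm e) (K₂.le_of_opNorm_le hK₂n e)
      calc _ ≤ M.ρmin⁻¹ * ((‖K₁‖ + CK) * ‖e‖ + η) := by gcongr
        _ = _ := by rw [hK]; ring
  rw [Metric.tendsto_nhds]
  intro θ hθ
  -- With zero initial error and fixed rate, the Gronwall bound is continuous in the residual size
  -- and vanishes at zero.
  have hlim : Tendsto (fun η => gronwallBound 0 (max 1 K) (M.ρmin⁻¹ * η) t) (𝓝[>] 0) (𝓝 0) := by
    have hc : Continuous fun η => gronwallBound 0 (max 1 K) (M.ρmin⁻¹ * η) t :=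
      (gronwallBound_continuous_ε 0 (max 1 K) t).comp (continuous_const.mul continuous_id)
    have h := hc.tendsto 0
    simp only [mul_zero, gronwallBound_ε0, zero_mul] at h
    exact h.mono_left nhdsWithin_le_nhds
  obtain ⟨η, hη, hη0⟩ := ((hlim.eventually_lt_const hθ).and self_mem_nhdsWithin).exists
  filter_upwards [hsmall, hunif η hη0] with ε hε hεη
  rw [dist_zero_right]
  exact (key ε hε.1 hε.2 η (le_of_lt hη0) hεη).trans_lt hη

/-! ### Averages -/

/-- Integration over a measurable part of the body. -/
theorem exists_setIntegral_operator {Ω V : Set E3} (hV : V ⊆ Ω) :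
    ∃ A : Lp E3 1 (volume.restrict Ω) →L[ℝ] E3, ∀ f, A f = ∫ x in V, f x := by
  have hle : volume.restrict V ≤ volume.restrict Ω := Measure.restrict_mono hV le_rfl
  have hint : ∀ f : Lp E3 1 (volume.restrict Ω), Integrable f (volume.restrict V) := fun f =>
    (L1.integrable_coeFn f).mono_measure hle
  let A : Lp E3 1 (volume.restrict Ω) →ₗ[ℝ] E3 :=
    { toFun := fun f => ∫ x in V, f x
      map_add' := fun f g => by
        rw [← integral_add (hint f) (hint g)]
        exact integral_congr_ae (ae_mono hle (Lp.coeFn_add f g))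
      map_smul' := fun c f => by
        rw [RingHom.id_apply, ← integral_smul]
        exact integral_congr_ae (ae_mono hle (Lp.coeFn_smul c f)) }
  refine ⟨A.mkContinuous 1 fun f => ?_, fun f => rfl⟩
  rw [one_mul, L1.norm_eq_integral_norm]
  exact (norm_integral_le_integral_norm _).trans
    (integral_mono_measure hle (ae_of_all _ fun x => norm_nonneg _) (L1.integrable_coeFn f).norm)

/-- Integration over `V` after subtracting the macroscopic part is bounded uniformly in small `ε`,
so simple fields suffice. For `1_s(y) φ(x)` the limit is weak convergence tested against `1_V φ`. -/
theorem tendsto_setIntegral_rescale_sub_macro {Ω : Set E3} {p : ℝ≥0∞} [Fact (1 ≤ p)]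
    (hp : p ≠ ∞) {R : ℝ} (hR : Ω ⊆ Metric.ball 0 R)
    {S : ℝ → TwoScaleField Ω p →L[ℝ] Lp E3 1 (volume.restrict Ω)}
    (hS : ∀ ε, 0 < ε → (∀ w, S ε w =ᵐ[volume.restrict Ω] w.rescale ε) ∧
      ‖S ε‖ ≤ (volume (Metric.ball (0 : E3) (R + ε))).toReal)
    {H : TwoScaleField Ω p →L[ℝ] Lp E3 1 (volume.restrict Ω)}
    (hH : ∀ w, H w =ᵐ[volume.restrict Ω] w.macro_part)
    {V : Set E3} (hV : MeasurableSet V) (hVΩ : V ⊆ Ω)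
    {A : Lp E3 1 (volume.restrict Ω) →L[ℝ] E3} (hA : ∀ f, A f = ∫ x in V, f x)
    (w : TwoScaleField Ω p) : Tendsto (fun ε => A (S ε w - H w)) (𝓝[>] 0) (𝓝 0) := by
  have hle : volume.restrict V ≤ volume.restrict Ω := Measure.restrict_mono hVΩ le_rfl
  refine TwoScaleField.tendsto_zero_of_simple hp (L := fun ε => A ∘L (S ε - H))
    (C := ‖A‖ * ((volume (Metric.ball (0 : E3) (R + 1))).toReal + ‖H‖)) ?_
    (fun s hs hμs φ => ?_) w
  · filter_upwards [Ioo_mem_nhdsGT one_pos] with ε hε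
    refine (A.opNorm_comp_le _).trans (mul_le_mul_of_nonneg_left ?_ (norm_nonneg _))
    refine (norm_sub_le (S ε) H).trans (add_le_add ((hS ε hε.1).2.trans ?_) le_rfl)
    exact ENNReal.toReal_mono measure_ball_lt_top.ne
      (measure_mono (Metric.ball_subset_ball (by linarith [hε.2])))
  · set g : E3 → E3 := V.indicator (TwoScaleField.extendZero φ)
    have hfin : volume V ≠ ∞ := ((measure_mono (hVΩ.trans hR)).trans_lt measure_ball_lt_top).ne
    have hgV : IntegrableOn (TwoScaleField.extendZero φ) V := by
      refine ⟨(TwoScaleField.measurable_extendZero φ).aestronglyMeasurable, ?_⟩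
      refine (lintegral_mono fun x => TwoScaleField.enorm_extendZero_le φ x).trans_lt ?_
      rw [setLIntegral_const]
      finiteness
    have hg : Integrable g := hgV.integrable_indicator hV
    set m := (volume.restrict unitCell).real s
    have ht := (tendsto_integral_rescale_indicator hs hg).sub_const (m • ∫ x, g x)
    rw [sub_self] at ht
    refine ht.congr' ?_
    filter_upwards [self_mem_nhdsWithin] with ε hε
    have hsm : Measurable fun x' : E3 => s.indicator (fun _ => (1 : ℝ)) (cellRep (ε⁻¹ • x')) :=
      (measurable_const.indicator hs).comp
        (measurable_cellRep.comp (measurable_id.const_smul ε⁻¹))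
    have hi : Integrable fun x =>
        s.indicator (fun _ => (1 : ℝ)) (cellRep (ε⁻¹ • x)) • g x := by
      refine hg.bdd_smul 1 hsm.aestronglyMeasurable (ae_of_all _ fun x' => ?_)
      by_cases h : cellRep (ε⁻¹ • x') ∈ s <;> simp [h]
    have hi' : Integrable fun x => m • g x := hg.smul m
    rw [← integral_smul, ← integral_sub hi hi', ContinuousLinearMap.comp_apply, hA,
      ← integral_indicator hV]
    refine integral_congr_ae ?_
    set w₀ := TwoScaleField.simpleField p hs hμs φ
    have hae : ∀ᵐ x ∂(volume.restrict V), ((S ε - H) w₀) x = w₀.rescale ε x - w₀.macro_part x := by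
      refine ae_mono hle ?_
      filter_upwards [(hS ε hε).1 w₀, hH w₀, Lp.coeFn_sub (S ε w₀) (H w₀)] with x h1 h2 h3
      rw [sub_apply, h3, Pi.sub_apply, h1, h2]
    filter_upwards [(ae_restrict_iff' hV).1 hae,
      TwoScaleField.ae_eval_indicatorConst_rescale (p := p) hs hμs φ hε] with x hx hx'
    by_cases hxV : x ∈ V
    · rw [indicator_of_mem hxV, hx hxV, TwoScaleField.rescale, hx',
        TwoScaleField.macro_part_indicatorConst]
      simp only [g, indicator_of_mem hxV]
      rfl
    · simp only [g, indicator_of_notMem hxV, smul_zero, sub_zero]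

end

theorem mainTheorem7 (M : PeridynamicMedium) (p : ℝ≥0∞) [Fact (1 ≤ p)]
    (hp : 3 / 2 < p) (hp_top : p ≠ ∞) (T : ℝ) (hT : 0 < T)
    (u₀ v₀ : TwoScaleField M.Ω p) (b : ℝ → TwoScaleField M.Ω p) (hb : ContinuousOn b (Icc 0 T))
    (uε : ℝ → ℝ → BodyField M.Ω p)
    (huε : ∀ ε : ℝ, 0 < ε → IsPeridynamicSolution M T u₀ v₀ b ε (uε ε))
    (u : ℝ → TwoScaleField M.Ω p) (hu : IsTwoScaleSolution M T u₀ v₀ b u)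
    (V : Set E3) (hV : MeasurableSet V) (hVΩ : V ⊆ M.Ω) (hV_pos : 0 < volume V)
    (t : ℝ) (ht : t ∈ Icc 0 T) :
    IntegrableOn (u t).macro_part V ∧
    (∀ ε : ℝ, 0 < ε → IntegrableOn (uε ε t) V ∧ IntegrableOn ((u t).rescale ε) V) ∧
    Tendsto (fun ε : ℝ => (volume.real V)⁻¹ • ∫ x in V, uε ε t x) (𝓝[>] 0)
      (𝓝 ((volume.real V)⁻¹ • ∫ x in V, (u t).macro_part x)) ∧
    Tendsto (fun ε : ℝ => (volume.real V)⁻¹ • ∫ x in V, (u t).rescale ε x) (𝓝[>] 0)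
      (𝓝 ((volume.real V)⁻¹ • ∫ x in V, (u t).macro_part x)) ∧
    Tendsto (fun ε : ℝ => (volume.real V)⁻¹ • ∫ x in V, (u t).corrector x (ε⁻¹ • x)) (𝓝[>] 0)
      (𝓝 0) := by
  obtain ⟨R, hR⟩ := M.isBounded_Ω.subset_ball 0
  have hle : volume.restrict V ≤ volume.restrict M.Ω := Measure.restrict_mono hVΩ le_rfl
  obtain ⟨I, hI⟩ := exists_inclusion_operator (p := p) M.isBounded_Ω.measure_lt_top.ne
  obtain ⟨H, hH⟩ := TwoScaleField.exists_macro_operator (p := p) hR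
  obtain ⟨A, hA⟩ := exists_setIntegral_operator hVΩ
  have hSex : ∀ ε : ℝ, ∃ S : TwoScaleField M.Ω p →L[ℝ] Lp E3 1 (volume.restrict M.Ω),
      0 < ε → _ := fun ε => (em (0 < ε)).elim
    (fun h => (TwoScaleField.exists_rescale_operator hR h).imp fun _ h _ => h)
    fun h => ⟨0, fun h' => absurd h' h⟩
  choose S hS using hSex
  -- Translates between integrals of concrete representatives over `V` and values of the functional
  -- `A` on `L¹` classes.
  have hint : ∀ (f : Lp E3 1 (volume.restrict M.Ω)) (g : E3 → E3),
      f =ᵐ[volume.restrict M.Ω] g → IntegrableOn g V ∧ ∫ x in V, g x = A f := fun f g hfg => by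
    have hfg' : f =ᵐ[volume.restrict V] g := ae_mono hle hfg
    exact ⟨((L1.integrable_coeFn f).mono_measure hle).congr hfg',
      (integral_congr_ae hfg'.symm).trans (hA f).symm⟩
  have i1 := hint _ _ (hH (u t))
  have i2 := fun ε hε => hint _ _ ((hS ε hε).1 (u t))
  have i3 := fun ε => hint _ _ (hI (uε ε t))
  have hlim := tendsto_setIntegral_rescale_sub_macro hp_top hR hS hH hV hVΩ hA (u t)
  have herr := (A.continuous.tendsto 0).comp
    (tendsto_error_zero hp_top hR hT hu huε hI (fun ε hε => (hS ε hε).1) ht)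
  rw [map_zero] at herr
  have hpos : ∀ᶠ ε : ℝ in 𝓝[>] 0, 0 < ε := self_mem_nhdsWithin
  have hresc : Tendsto (fun ε : ℝ => ∫ x in V, (u t).rescale ε x) (𝓝[>] 0)
      (𝓝 (∫ x in V, (u t).macro_part x)) := by
    have h := hlim.add_const (A (H (u t)))
    rw [zero_add, ← i1.2] at h
    refine h.congr' (hpos.mono fun ε hε => ?_)
    beta_reduce
    rw [(i2 ε hε).2, i1.2, map_sub, sub_add_cancel]
  have hsol : Tendsto (fun ε : ℝ => ∫ x in V, uε ε t x) (𝓝[>] 0)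
      (𝓝 (∫ x in V, (u t).macro_part x)) := by
    have h := herr.add hresc
    rw [zero_add] at h
    refine h.congr' (hpos.mono fun ε hε => ?_)
    beta_reduce
    rw [(i2 ε hε).2, (i3 ε).2, Function.comp_apply, map_sub, sub_add_cancel]
  refine ⟨i1.1, fun ε hε => ⟨(i3 ε).1, (i2 ε hε).1⟩, hsol.const_smul _, hresc.const_smul _, ?_⟩
  -- The corrector at `y = x/ε` is the rescaled field minus its macroscopic part, so this is the
  -- limit `hlim` itself.
  have hcorr : Tendsto (fun ε : ℝ => ∫ x in V, (u t).corrector x (ε⁻¹ • x)) (𝓝[>] 0) (𝓝 0) := by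
    refine hlim.congr' (hpos.mono fun ε hε => ?_)
    rw [map_sub, ← (i2 ε hε).2, ← i1.2, ← integral_sub (i2 ε hε).1 i1.1]
    rfl
  simpa using hcorr.const_smul (volume.real V)⁻¹
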